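/- Terminology. A $\mathbb Z$-group is a model $(G,+,\le)$ of Presburger arithmetic $\mathrm{Th}(\mathbb Z,+,\le)$; it is an ordered abelian group with a least positive element, denoted $1$. A structure is rigid if its only automorphism is the identity, and Leibnizian if any two distinct elements $a,b$ are separated by a parameter-free first-order formula $\varphi(x)$ (true of $a$ and false of $b$). Let $\hat{\mathbb Z}=\varprojlim_{n>0}\mathbb Z/n\mathbb Z$, and let $\mathrm{res}\colon G\to\hat{\mathbb Z}$ be the unique group homomorphism with $\mathrm{res}(1)=1$. A standard decomposition of a $\mathbb Z$-group $G$ is an internal direct sum of groups $G=D\oplus L$, where $D=\ker(\mathrm{res})$ is divisible and $L$ is a subgroup such that $(L,+,1)$ is an elementary substructure of $(G,+,1)$ and is Leibnizian. Corollary (cor:card-nonleib). (i) For all infinite cardinals $\kappa,\lambda\le2^{\aleph_0}$ there is a non-Leibnizian rigid $\mathbb Z$-group $G$ with a standard decomposition $G=D\oplus L$ such that $|D|=\kappa$ and $|L|=\lambda$. (ii) For every infinite cardinal $\kappa\le2^{\aleph_0}$ there is a non-archimedean Leibnizian $\mathbb Z$-group of cardinality $\kappa$, and it is rigid. (iii)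 Consequently, Presburger arithmetic has rigid models of every infinite cardinality $\kappa\le2^{\aleph_0}$. -/

import Mathlib

open FirstOrder Cardinal

/-! ### General model theory -/

/-- A structure is Leibnizian if any two distinct elements are separated by a formula in one free
variable without parameters. -/
def IsLeibnizian (𝓛 : Language) (M : Type*) [𝓛.Structure M] : Prop :=
  ∀ a b : M, a ≠ b →
    ∃ φ : 𝓛.Formula (Fin 1), φ.Realize (fun _ => a) ∧ ¬ φ.Realize (fun _ => b)

/-- A structure is rigid if the identity is its only automorphism. -/
def IsRigid (𝓛 : Language) (M : Type*) [𝓛.Structure M] : Prop :=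
  ∀ f : 𝓛.Equiv M M, ∀ x : M, f x = x

/-! ### Ordered `ℤ`-groups, in the language `{+, ≤}` -/

/-- The function symbols of the language `{+, ≤}`. -/
inductive AddLeFunc : ℕ → Type
  | add : AddLeFunc 2

/-- The relation symbols of the language `{+, ≤}`. -/
inductive AddLeRel : ℕ → Type
  | le : AddLeRel 2

/-- The first-order language `{+, ≤}` of ordered groups. -/
def addLeLang : Language := ⟨AddLeFunc, AddLeRel⟩

/-- The structure `(G, +, ≤)`. -/
instance addLeStructure (G : Type*) [Add G] [LE G] : addLeLang.Structure G where
  funMap := fun {_} f => match f with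
    | AddLeFunc.add => fun v => v 0 + v 1
  RelMap := fun {_} r => match r with
    | AddLeRel.le => fun v => v 0 ≤ v 1

/-- `ℤ`-groups: models of `Th(ℤ, +, ≤)`, the complete theory of the ordered group of integers. -/
def IsOrderedZGroup (G : Type*) [Add G] [LE G] : Prop :=
  G ⊨ addLeLang.completeTheory ℤ

/-! ### The reduct `(G, +, 1)` of a `ℤ`-group, and its decomposition `G = D ⊕ L` -/

/-- The function symbols of the language `{+, 1}`. -/
inductive AddOneFunc : ℕ → Type
  | add : AddOneFunc 2
  | one : AddOneFunc 0

/-- The first-order language `{+, 1}` of unordered `ℤ`-groups. -/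
def addOneLang : Language := ⟨AddOneFunc, fun _ => Empty⟩

/-- The structure `(G, +, 1)`, where the constant `1` is interpreted by the given element `one`. -/
@[reducible]
def addOneStructure {G : Type*} [Add G] (one : G) : addOneLang.Structure G where
  funMap := fun {_} f => match f with
    | AddOneFunc.add => fun v => v 0 + v 1
    | AddOneFunc.one => fun _ => one
  RelMap := fun {_} r => Empty.elim r

/-- The profinite completion of `ℤ`, i.e. the inverse limit of the rings `ℤ/nℤ` for `n > 0`, as a
subring of their product. -/
def ZHat : Subring (∀ n : ℕ+, ZMod n) where
  carrier := {x | ∀ (m n : ℕ+) (h : (m : ℕ) ∣ n), ZMod.castHom h (ZMod m) (x n) = x m}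
  mul_mem' := fun hx hy m n h => by
    rw [Pi.mul_apply, Pi.mul_apply, map_mul, hx m n h, hy m n h]
  one_mem' := fun m n h => by rw [Pi.one_apply, Pi.one_apply, map_one]
  add_mem' := fun hx hy m n h => by
    rw [Pi.add_apply, Pi.add_apply, map_add, hx m n h, hy m n h]
  zero_mem' := fun m n h => by rw [Pi.zero_apply, Pi.zero_apply, map_zero]
  neg_mem' := fun hx m n h => by
    rw [Pi.neg_apply, Pi.neg_apply, map_neg, hx m n h]

/-- `res` is the residue map of `(G, +, 1)`: the unique group homomorphism `G → ZHat` that sends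
the distinguished element `one` to `1`. -/
def IsResidueMap {G : Type*} [AddCommGroup G] (one : G) (res : G →+ ZHat) : Prop :=
  res one = 1 ∧ ∀ res' : G →+ ZHat, res' one = 1 → res' = res

/-- `L` is a Leibnizian `ℤ`-subgroup of `(G, +, 1)`: it is (the universe of) an elementary
substructure of `(G, +, 1)`, and this substructure is Leibnizian. -/
def IsLeibnizianZSubgroup {G : Type*} [AddCommGroup G] (one : G) (L : AddSubgroup G) : Prop :=
  letI : addOneLang.Structure G := addOneStructure one
  ∃ S : addOneLang.ElementarySubstructure G, (S : Set G) = (L : Set G) ∧ IsLeibnizian addOneLang S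

/-- `G = D ⊕ L` (internal direct sum of groups), where `D` is the kernel of the residue map and is
divisible, and `L` is a Leibnizian `ℤ`-subgroup of `(G, +, 1)`. -/
structure IsStandardDecomposition {G : Type*} [AddCommGroup G] (one : G) (D L : AddSubgroup G) :
    Prop where
  isCompl : IsCompl D L
  eq_ker : ∃ res : G →+ ZHat, IsResidueMap one res ∧ D = res.ker
  divisible : ∀ n : ℕ, 0 < n → ∀ a ∈ D, ∃ b ∈ D, n • b = a
  leibnizian : IsLeibnizianZSubgroup one L

/-!
A `ℤ`-group `G` is handled through its least positive element `1` and its residue map to `ZHat`,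
whose values detect divisibility (`ZGroupData`). Two tuples in `ℤ`-groups satisfy the same formulas
of bounded complexity as soon as finitely many integral affine forms have the same signs on both
and the entries have the same residues modulo one integer (`exists_agree_realize_iff`). This is
quantifier elimination for Presburger arithmetic in the form of a graded back-and-forth; its core is
`exists_same_cut`, which transfers a cut together with a residue from one group to another. It
gives the following.

* Every group with a `ZGroupData` is a model of `Th(ℤ, +, ≤)` (`isOrderedZGroup`).
* A positive infinite `d` in the kernel of the residue map has the same type as `2 d`, so a
  `ℤ`-group with such an element is not Leibnizian (`not_isLeibnizian`).
* A subgroup which is a `ℤ`-group with the same `1` is elementary in `(G, +, 1)`, by the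
  Tarski–Vaught test (`isLeibnizianZSubgroup`).

Residues are definable, so `G` is Leibnizian, hence rigid, whenever its residue map is injective.

For the examples, `ZHat / ℤ` embeds into a rational vector space with a basis of cardinality
continuum (`ZHat.exists_coordinates`). Send this basis to part of an algebraically independent
family of reals, and let the field `F` be generated by further members of that family. The result is
a map `σ : ZHat → ℝ` with kernel `ℤ` whose image meets `F` trivially. For a pure subgroup `L` of
`ZHat` and a rational subspace `D ⊆ F`, the group `L × D` ordered by `σ l + d`, with ties broken on
the kernel `ℤ`, is a `ℤ`-group with standard decomposition `D ⊕ L` and with an archimedean quotient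
modulo `ℤ`. An automorphism preserves residues and rescales this quotient by a real number `r`.
Acting on `D`, it shows `r ∈ F`; acting on an element `l` of `L` with `σ l ∉ F`, which it moves by an
element of `D`, it shows `(r - 1) σ l ∈ F`. Hence `r = 1`, and `L × D` is rigid (`isRigid`). The
Leibnizian groups are those with `D = 0`.
-/

/-! ### Residues -/

theorem ZHat.cast_apply (z : ZHat) {m n : ℕ+} (h : (m : ℕ) ∣ n) :
    ZMod.castHom h (ZMod m) (z.1 n) = z.1 m := z.2 m n h

theorem ZHat.apply_eq_of_dvd {z w : ZHat} {m n : ℕ+} (h : (m : ℕ) ∣ n) (e : z.1 n = w.1 n) :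
    z.1 m = w.1 m := by
  rw [← ZHat.cast_apply z h, ← ZHat.cast_apply w h, e]

theorem ZHat.apply_eq_zero_of_nsmul {z : ZHat} {k m : ℕ+} (e : ((k : ℕ) • z).1 (k * m) = 0) :
    z.1 m = 0 := by
  have hd : (m : ℕ) ∣ (k * m : ℕ+) := by simp
  have h1 : ((k : ℕ) • z).1 (k * m) = (k : ℕ) • z.1 (k * m) := rfl
  obtain ⟨r, hr⟩ : ∃ r : ℕ, z.1 (k * m) = (r : ZMod (k * m : ℕ+)) :=
    ⟨(z.1 (k * m)).val, (ZMod.natCast_zmod_val _).symm⟩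
  rw [h1, hr, nsmul_eq_mul, ← Nat.cast_mul, ZMod.natCast_eq_zero_iff, PNat.mul_coe] at e
  rw [← ZHat.cast_apply z hd, hr, map_natCast, ZMod.natCast_eq_zero_iff]
  exact (Nat.mul_dvd_mul_iff_left k.pos).1 e

/-! ### Graded back-and-forth between `ℤ`-groups -/

/-- The data of a `ℤ`-group in algebraic form: a least positive element `one` and a residue map to
`ZHat` which sends `one` to `1` and detects divisibility by every positive integer. -/
structure ZGroupData (G : Type) [AddCommGroup G] [LinearOrder G] where
  one : G
  res : G →+ ZHat
  least : IsLeast {x : G | 0 < x} one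
  res_one : res one = 1
  div : ∀ (n : ℕ+) (x : G), (res x).1 n = 0 → ∃ y, (n : ℕ) • y = x

namespace ZGroupData

section Basic

variable {G : Type} [AddCommGroup G] [LinearOrder G] (A : ZGroupData G)

theorem one_pos : 0 < A.one := A.least.1

theorem one_le {x : G} (h : 0 < x) : A.one ≤ x := A.least.2 h

/-- The residue of `x` modulo `n`. -/
def mod (n : ℕ+) : G →+ ZMod n where
  toFun x := (A.res x).1 n
  map_zero' := by rw [map_zero]; rfl
  map_add' x y := by rw [map_add]; rfl

@[simp]
theorem mod_one (n : ℕ+) : A.mod n A.one = 1 := by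
  change (A.res A.one).1 n = 1
  rw [A.res_one]; rfl

theorem exists_of_mod_eq_zero {n : ℕ+} {x : G} (h : A.mod n x = 0) : ∃ y, (n : ℕ) • y = x :=
  A.div n x h

/-- Division with remainder by `n`. -/
theorem exists_eq_nsmul_add (n : ℕ+) (x : G) :
    ∃ y : G, ∃ r : ℕ, r < n ∧ x = (n : ℕ) • y + r • A.one := by
  obtain ⟨y, hy⟩ := A.exists_of_mod_eq_zero (n := n) (x := x - (A.mod n x).val • A.one) (by simp)
  exact ⟨y, _, ZMod.val_lt _, by rw [hy]; abel⟩

variable [IsOrderedAddMonoid G]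

/-- A positive element exceeds, in the weak sense, a representative in `[1, n]` of its residue. -/
theorem exists_nsmul_one_le {z : G} (hz : 0 < z) (n : ℕ+) :
    ∃ j : ℕ, 1 ≤ j ∧ j ≤ n ∧ j • A.one ≤ z ∧ A.mod n z = j := by
  obtain ⟨y, r, hr, h⟩ := A.exists_eq_nsmul_add n z
  rcases Nat.eq_zero_or_pos r with rfl | hr0
  · refine ⟨n, n.pos, le_rfl, ?_, by simp [h]⟩
    rw [zero_smul, add_zero] at h
    have hy : 0 < y := by
      by_contra hy
      exact absurd (h ▸ hz) (not_lt.2 (nsmul_nonpos (not_lt.1 hy) _))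
    rw [h]
    exact nsmul_le_nsmul_right (A.one_le hy) _
  · refine ⟨r, hr0, hr.le, ?_, by simp [h]⟩
    have hy : 0 ≤ y := by
      by_contra hy
      have h1 : A.one ≤ -y := A.one_le (neg_pos.2 (not_le.1 hy))
      have h2 : r • A.one ≤ (n : ℕ) • A.one := nsmul_le_nsmul_left A.one_pos.le hr.le
      have h3 : (n : ℕ) • A.one ≤ (n : ℕ) • (-y) := nsmul_le_nsmul_right h1 _
      rw [smul_neg] at h3
      have h4 : (n : ℕ) • y + r • A.one ≤ 0 := by
        calc _ ≤ (n : ℕ) • y + -((n : ℕ) • y) := by gcongr; exact h2.trans h3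
          _ = 0 := by abel
      exact absurd (h ▸ hz) (not_lt.2 h4)
    rw [h]
    exact le_add_of_nonneg_left (nsmul_nonneg hy _)

end Basic

section BackAndForth

variable {G H : Type} [AddCommGroup G] [LinearOrder G] [IsOrderedAddMonoid G]
  [AddCommGroup H] [LinearOrder H] [IsOrderedAddMonoid H] (A : ZGroupData G) (B : ZGroupData H)

/-- Cuts with a prescribed residue transfer from `G` to `H`: if two finite families are ordered in
the same way up to bounded integer shifts, then every cut-and-residue condition modulo `Q` that is
realized over the first family is realized over the second one. -/
theorem exists_same_cut {σ : Type} (T : Finset σ) (hT : T.Nonempty) (Q : ℕ+) (p : σ → G)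
    (q : σ → H)
    (hord : ∀ s ∈ T, ∀ t ∈ T, ∀ j : ℤ, |j| ≤ (Q : ℕ) →
      (p s + j • A.one ≤ p t ↔ q s + j • B.one ≤ q t))
    (hres : ∀ s ∈ T, A.mod Q (p s) = B.mod Q (q s)) (X : G) :
    ∃ Y : H, A.mod Q X = B.mod Q Y ∧ ∀ s ∈ T, (p s ≤ X ↔ q s ≤ Y) ∧ (X ≤ p s ↔ Y ≤ q s) := by
  have hord0 : ∀ s ∈ T, ∀ t ∈ T, (p s ≤ p t ↔ q s ≤ q t) := fun s hs t ht => by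
    simpa using hord s hs t ht 0 (by simp)
  -- `Y` is placed next to the image of the largest point of the family below `X`, or, if there is
  -- none, next to the image of the smallest point above `X`
  by_cases hne : ∃ s ∈ T, p s ≤ X
  · obtain ⟨s₁, hs₁, hmax⟩ := (T.filter (fun s => p s ≤ X)).exists_max_image p
      (by obtain ⟨s, hs, h⟩ := hne; exact ⟨s, Finset.mem_filter.2 ⟨hs, h⟩⟩)
    obtain ⟨hs₁', hle⟩ := Finset.mem_filter.1 hs₁
    rcases hle.eq_or_lt with rfl | hlt
    · exact ⟨q s₁, hres _ hs₁', fun s hs => ⟨hord0 _ hs _ hs₁', hord0 _ hs₁' _ hs⟩⟩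
    obtain ⟨j, hj1, hjQ, hjle, hjres⟩ := A.exists_nsmul_one_le (sub_pos.2 hlt) Q
    have hjpos : 0 < j • B.one := nsmul_pos B.one_pos (by omega)
    refine ⟨q s₁ + j • B.one, ?_, fun s hs => ?_⟩
    · have : X = (X - p s₁) + p s₁ := by abel
      rw [this, map_add, hjres, map_add, hres _ hs₁']
      simp [add_comm]
    · by_cases hsX : p s ≤ X
      · have h1 : p s ≤ p s₁ := hmax s (Finset.mem_filter.2 ⟨hs, hsX⟩)
        have h2 : q s < q s₁ + j • B.one :=
          ((hord0 _ hs _ hs₁').1 h1).trans_lt (lt_add_of_pos_right _ hjpos)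
        exact ⟨iff_of_true hsX h2.le, iff_of_false (h1.trans_lt hlt).not_ge h2.not_ge⟩
      · have hsX' := not_le.1 hsX
        have h1 : ¬ p s + (-(j : ℤ)) • A.one ≤ p s₁ := by
          intro h
          rw [neg_smul, natCast_zsmul, ← sub_eq_add_neg, sub_le_iff_le_add] at h
          exact hsX (h.trans (by rwa [le_sub_iff_add_le'] at hjle))
        rw [hord _ hs _ hs₁' _ (by rw [abs_neg, Nat.abs_cast]; exact_mod_cast hjQ),
          neg_smul, natCast_zsmul, ← sub_eq_add_neg, sub_le_iff_le_add, not_le] at h1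
        exact ⟨iff_of_false hsX h1.not_ge, iff_of_true hsX'.le h1.le⟩
  · push Not at hne
    obtain ⟨s₂, hs₂, hmin⟩ := T.exists_min_image p hT
    obtain ⟨j, hj1, hjQ, -, hjres⟩ := A.exists_nsmul_one_le (sub_pos.2 (hne s₂ hs₂)) Q
    have hjpos : 0 < j • B.one := nsmul_pos B.one_pos (by omega)
    refine ⟨q s₂ - j • B.one, ?_, fun s hs => ?_⟩
    · have : X = p s₂ - (p s₂ - X) := by abel
      rw [this, map_sub, hjres, map_sub, hres _ hs₂]
      simp
    · have h2 : q s₂ - j • B.one < q s :=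
        (sub_lt_self _ hjpos).trans_le ((hord0 _ hs₂ _ hs).1 (hmin s hs))
      exact ⟨iff_of_false (hne s hs).not_ge h2.not_ge, iff_of_true (hne s hs).le h2.le⟩

end BackAndForth

section Forms

variable {G : Type} [AddCommGroup G] [LinearOrder G] (A : ZGroupData G) {ι : Type} [Fintype ι]

/-- The value at the tuple `a` of the affine form with coefficients `f.1` and constant `f.2`. -/
def eval (a : ι → G) : ((ι → ℤ) × ℤ) →+ G where
  toFun f := ∑ i, f.1 i • a i + f.2 • A.one
  map_zero' := by simp
  map_add' f g := by simp [add_smul, Finset.sum_add_distrib]; abel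

theorem eval_apply (a : ι → G) (f : (ι → ℤ) × ℤ) :
    A.eval a f = ∑ i, f.1 i • a i + f.2 • A.one := rfl

theorem eval_const (a : ι → G) (j : ℤ) : A.eval a (0, j) = j • A.one := by simp [eval_apply]

/-- The restriction of an affine form to the variables other than the last one. -/
def dropLast {α : Type} {n : ℕ} (f : ((α ⊕ Fin (n + 1)) → ℤ) × ℤ) : ((α ⊕ Fin n) → ℤ) × ℤ :=
  (fun i => f.1 (i.map id Fin.castSucc), f.2)

theorem eval_snoc {α : Type} [Fintype α] {n : ℕ} (v : α → G) (xs : Fin n → G) (x : G)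
    (f : ((α ⊕ Fin (n + 1)) → ℤ) × ℤ) :
    A.eval (Sum.elim v (Fin.snoc xs x)) f =
      A.eval (Sum.elim v xs) (dropLast f) + f.1 (Sum.inr (Fin.last n)) • x := by
  simp [eval_apply, dropLast, Fintype.sum_sum_type, Fin.sum_univ_castSucc]
  abel

end Forms

section Agree

variable {G H : Type} [AddCommGroup G] [LinearOrder G]
  [AddCommGroup H] [LinearOrder H] (A : ZGroupData G) (B : ZGroupData H)

/-- Two tuples agree at level `(F, m)` if the affine forms in `F` have the same sign on both, and
their entries have the same residues modulo `m`. -/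
def Agree {ι : Type} [Fintype ι] (F : Finset ((ι → ℤ) × ℤ)) (m : ℕ+) (a : ι → G) (b : ι → H) :
    Prop :=
  (∀ f ∈ F, 0 ≤ A.eval a f ↔ 0 ≤ B.eval b f) ∧ ∀ i, A.mod m (a i) = B.mod m (b i)

variable {A B}

theorem Agree.symm {ι : Type} [Fintype ι] {F : Finset ((ι → ℤ) × ℤ)} {m : ℕ+} {a : ι → G}
    {b : ι → H} (h : Agree A B F m a b) : Agree B A F m b a :=
  ⟨fun f hf => (h.1 f hf).symm, fun i => (h.2 i).symm⟩

theorem mod_eq_of_dvd {m n : ℕ+} (h : (m : ℕ) ∣ n) {x : G} {y : H} (e : A.mod n x = B.mod n y) :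
    A.mod m x = B.mod m y :=
  ZHat.apply_eq_of_dvd h e

theorem Agree.mono {ι : Type} [Fintype ι] {F F' : Finset ((ι → ℤ) × ℤ)} {m m' : ℕ+} {a : ι → G}
    {b : ι → H} (h : Agree A B F m a b) (hF : F' ⊆ F) (hm : (m' : ℕ) ∣ m) :
    Agree A B F' m' a b :=
  ⟨fun f hf => h.1 f (hF hf), fun i => mod_eq_of_dvd hm (h.2 i)⟩

theorem Agree.mod_eval {ι : Type} [Fintype ι] {F : Finset ((ι → ℤ) × ℤ)} {m : ℕ+} {a : ι → G}
    {b : ι → H} (h : Agree A B F m a b) (f : (ι → ℤ) × ℤ) :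
    A.mod m (A.eval a f) = B.mod m (B.eval b f) := by
  simp [eval_apply, h.2]

/-- The forth step: a level for the extended tuples is reached from a suitable level for the given
tuples. Multiplying the forms to a common leading coefficient `K` turns the conditions on the new
entry `x` into a cut for `K • x`, together with a residue. -/
theorem exists_agree_snoc [IsOrderedAddMonoid G] [IsOrderedAddMonoid H] {α : Type} [Fintype α] {n : ℕ}
    (F : Finset (((α ⊕ Fin (n + 1)) → ℤ) × ℤ)) (m : ℕ+) :
    ∃ (F' : Finset (((α ⊕ Fin n) → ℤ) × ℤ)) (m' : ℕ+),
      ∀ (v : α → G) (xs : Fin n → G) (w : α → H) (ys : Fin n → H),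
        Agree A B F' m' (Sum.elim v xs) (Sum.elim w ys) →
        ∀ x : G, ∃ y : H,
          Agree A B F m (Sum.elim v (Fin.snoc xs x)) (Sum.elim w (Fin.snoc ys y)) := by
  classical
  let lead (f : ((α ⊕ Fin (n + 1)) → ℤ) × ℤ) : ℤ := f.1 (Sum.inr (Fin.last n))
  -- a common multiple of the leading coefficients
  obtain ⟨K, hK⟩ : ∃ K : ℕ+, ∀ f ∈ F, lead f ≠ 0 → lead f ∣ (K : ℕ) := by
    refine ⟨⟨∏ f ∈ F, if lead f = 0 then 1 else (lead f).natAbs, Finset.prod_pos fun f _ => ?_⟩,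
      fun f hf h0 => ?_⟩
    · split_ifs with h
      · exact Nat.one_pos
      · exact Int.natAbs_pos.2 h
    · rw [← Int.natAbs_dvd_natAbs]
      have := Finset.dvd_prod_of_mem (fun f => if lead f = 0 then 1 else (lead f).natAbs) hf
      rwa [if_neg h0] at this
  -- the bound that the form `f` puts on `K • x`
  let bd (f : ((α ⊕ Fin (n + 1)) → ℤ) × ℤ) : ((α ⊕ Fin n) → ℤ) × ℤ :=
    (-((K : ℕ) / lead f : ℤ)) • dropLast f
  -- a `Y` with the residue of `K • x` modulo `K * m` is of the form `K • y`, and `y` then has the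
  -- residue of `x` modulo `m`
  let Q := K * m
  let T := insert 0 (F.image bd)
  refine ⟨F.image dropLast ∪ (T ×ˢ T ×ˢ Finset.Icc (-(Q : ℕ) : ℤ) (Q : ℕ)).image
    (fun u => u.2.1 - (u.1 + (0, u.2.2))), Q, fun v xs w ys hag x => ?_⟩
  have hord : ∀ s ∈ T, ∀ t ∈ T, ∀ j : ℤ, |j| ≤ (Q : ℕ) →
      (A.eval (Sum.elim v xs) s + j • A.one ≤ A.eval (Sum.elim v xs) t ↔
        B.eval (Sum.elim w ys) s + j • B.one ≤ B.eval (Sum.elim w ys) t) := by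
    intro s hs t ht j hj
    have h := hag.1 (t - (s + (0, j))) (Finset.mem_union_right _ (Finset.mem_image.2
      ⟨(s, t, j), by simpa [hs, ht] using abs_le.1 hj, rfl⟩))
    rwa [map_sub, map_sub, map_add, map_add, eval_const, eval_const, sub_nonneg, sub_nonneg] at h
  obtain ⟨Y, hYres, hY⟩ := exists_same_cut A B T (Finset.insert_nonempty _ _) Q
    (A.eval (Sum.elim v xs)) (B.eval (Sum.elim w ys)) hord
    (fun s _ => hag.mod_eval s) ((K : ℕ) • x)
  have hYK : B.mod K Y = 0 := by
    have := mod_eq_of_dvd (A := A) (B := B) (m := K) (n := Q) (by simp [Q]) hYres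
    rw [← this, map_nsmul, nsmul_eq_mul]; simp
  obtain ⟨y, rfl⟩ := B.exists_of_mod_eq_zero hYK
  refine ⟨y, fun f hf => ?_, ?_⟩
  · rw [eval_snoc, eval_snoc]
    by_cases h0 : lead f = 0
    · have h0' : f.1 (Sum.inr (Fin.last n)) = 0 := h0
      rw [h0', zero_smul, zero_smul, add_zero, add_zero]
      exact hag.1 _ (Finset.mem_union_left _ (Finset.mem_image_of_mem _ hf))
    · obtain ⟨c, hc⟩ := hK f hf h0
      have hcK : ((K : ℕ) / lead f : ℤ) = c := by rw [hc, Int.mul_ediv_cancel_left _ h0]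
      have hbd : bd f = (-c) • dropLast f := by simp only [bd, hcK]
      obtain ⟨h1, h2⟩ := hY (bd f) (Finset.mem_insert_of_mem (Finset.mem_image_of_mem _ hf))
      rw [hbd, map_zsmul, map_zsmul, ← natCast_zsmul x, ← natCast_zsmul y, hc] at h1 h2
      change 0 ≤ _ + lead f • x ↔ 0 ≤ _ + lead f • y
      have hK0 : (0 : ℤ) < lead f * c := by rw [← hc]; exact_mod_cast K.pos
      rcases lt_or_gt_of_ne h0 with hneg | hpos
      · have hc0 : 0 < -c := by nlinarith
        have key : ∀ {G : Type} [AddCommGroup G] [LinearOrder G] [IsOrderedAddMonoid G]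
            (g z : G), 0 ≤ g + lead f • z ↔ (lead f * c) • z ≤ (-c) • g := by
          intro G _ _ _ g z
          rw [← zsmul_le_zsmul_iff_right hc0, smul_zero, smul_add, smul_smul,
            show -c * lead f = -(lead f * c) by ring, neg_smul (lead f * c), ← sub_eq_add_neg,
            sub_nonneg]
        rw [key, key, h2]
      · have hc0 : 0 < c := by nlinarith
        have key : ∀ {G : Type} [AddCommGroup G] [LinearOrder G] [IsOrderedAddMonoid G]
            (g z : G), 0 ≤ g + lead f • z ↔ (-c) • g ≤ (lead f * c) • z := by
          intro G _ _ _ g z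
          rw [← zsmul_le_zsmul_iff_right hc0, smul_zero, smul_add, smul_smul,
            show c * lead f = (lead f * c) by ring, neg_smul, neg_le_iff_add_nonneg']
        rw [key, key, h1]
  · have hxy : A.mod m x = B.mod m y := by
      have h1 : ((K : ℕ) • (A.res x - B.res y)).1 Q = 0 := by
        rw [smul_sub, ← map_nsmul, ← map_nsmul]
        exact sub_eq_zero.2 hYres
      exact sub_eq_zero.1 (ZHat.apply_eq_zero_of_nsmul h1)
    rintro (i | i)
    · exact mod_eq_of_dvd (by simp [Q]) (hag.2 (Sum.inl i))
    · induction i using Fin.lastCases with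
      | last => simpa using hxy
      | cast i => simpa using mod_eq_of_dvd (m := m) (n := Q) (by simp [Q]) (hag.2 (Sum.inr i))

end Agree

end ZGroupData

/-! ### Transfer of first-order formulas -/

namespace ZGroupData

theorem eval_single {G : Type} [AddCommGroup G] [LinearOrder G] (A : ZGroupData G)
    {ι : Type} [Fintype ι] [DecidableEq ι] (a : ι → G) (i : ι) :
    A.eval a (Pi.single i 1, 0) = a i := by
  simp [eval_apply, Pi.single_apply]

section Formulas

open Language

variable {G H : Type} [AddCommGroup G] [LinearOrder G] [IsOrderedAddMonoid G]
  [AddCommGroup H] [LinearOrder H] [IsOrderedAddMonoid H] (A : ZGroupData G) (B : ZGroupData H)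
  {α : Type} [Fintype α]

/-- Formulas are preserved by agreement at a sufficiently high level, for every language whose
terms are affine forms and whose relations are controlled by agreement. -/
theorem exists_agree_realize_iff (𝓛 : FirstOrder.Language.{0, 0}) [𝓛.Structure G] [𝓛.Structure H]
    (hterm : ∀ {n : ℕ} (t : 𝓛.Term (α ⊕ Fin n)), ∃ f, ∀ (a : α ⊕ Fin n → G) (b : α ⊕ Fin n → H),
      t.realize a = A.eval a f ∧ t.realize b = B.eval b f)
    (hrel : ∀ {n k : ℕ} (R : 𝓛.Relations k) (ts : Fin k → 𝓛.Term (α ⊕ Fin n)), ∃ F m,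
      ∀ (a : α ⊕ Fin n → G) (b : α ⊕ Fin n → H), Agree A B F m a b →
        (Structure.RelMap R (fun i => (ts i).realize a) ↔
          Structure.RelMap R (fun i => (ts i).realize b)))
    {n : ℕ} (φ : 𝓛.BoundedFormula α n) :
    ∃ F m, ∀ (v : α → G) (xs : Fin n → G) (w : α → H) (ys : Fin n → H),
      Agree A B F m (Sum.elim v xs) (Sum.elim w ys) → (φ.Realize v xs ↔ φ.Realize w ys) := by
  classical
  induction φ with
  | falsum => exact ⟨∅, 1, fun _ _ _ _ _ => Iff.rfl⟩
  | equal t₁ t₂ =>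
    obtain ⟨f₁, h₁⟩ := hterm t₁
    obtain ⟨f₂, h₂⟩ := hterm t₂
    refine ⟨{f₁ - f₂, f₂ - f₁}, 1, fun v xs w ys h => ?_⟩
    have e₁ := h.1 (f₁ - f₂) (by simp)
    have e₂ := h.1 (f₂ - f₁) (by simp)
    rw [map_sub, map_sub, sub_nonneg, sub_nonneg] at e₁ e₂
    change t₁.realize (Sum.elim v xs) = t₂.realize (Sum.elim v xs) ↔
      t₁.realize (Sum.elim w ys) = t₂.realize (Sum.elim w ys)
    rw [(h₁ _ (Sum.elim w ys)).1, (h₂ _ (Sum.elim w ys)).1, (h₁ (Sum.elim v xs) _).2,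
      (h₂ (Sum.elim v xs) _).2, le_antisymm_iff, le_antisymm_iff, e₁, e₂]
  | rel R ts =>
    obtain ⟨F, m, h⟩ := hrel R ts
    exact ⟨F, m, fun v xs w ys hag => h _ _ hag⟩
  | imp φ ψ ihφ ihψ =>
    obtain ⟨F₁, m₁, h₁⟩ := ihφ
    obtain ⟨F₂, m₂, h₂⟩ := ihψ
    refine ⟨F₁ ∪ F₂, m₁ * m₂, fun v xs w ys h => ?_⟩
    rw [BoundedFormula.realize_imp, BoundedFormula.realize_imp,
      h₁ _ _ _ _ (h.mono Finset.subset_union_left (by simp)),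
      h₂ _ _ _ _ (h.mono Finset.subset_union_right (by simp))]
  | all φ ih =>
    obtain ⟨F, m, hφ⟩ := ih
    obtain ⟨F₁, m₁, h₁⟩ := exists_agree_snoc (A := A) (B := B) F m
    obtain ⟨F₂, m₂, h₂⟩ := exists_agree_snoc (A := B) (B := A) F m
    refine ⟨F₁ ∪ F₂, m₁ * m₂, fun v xs w ys h => ?_⟩
    rw [BoundedFormula.realize_all, BoundedFormula.realize_all]
    constructor
    · intro hall y
      obtain ⟨x, hx⟩ := h₂ _ _ _ _ (h.symm.mono Finset.subset_union_right (by simp)) y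
      exact (hφ _ _ _ _ hx.symm).1 (hall x)
    · intro hall x
      obtain ⟨y, hy⟩ := h₁ _ _ _ _ (h.mono Finset.subset_union_left (by simp)) x
      exact (hφ _ _ _ _ hy).2 (hall y)

theorem exists_form_addLeLang {G H : Type} [AddCommGroup G] [LinearOrder G] [AddCommGroup H]
    [LinearOrder H] (A : ZGroupData G) (B : ZGroupData H) {ι : Type} [Fintype ι] (t : addLeLang.Term ι) :
    ∃ f, ∀ (a : ι → G) (b : ι → H), t.realize a = A.eval a f ∧ t.realize b = B.eval b f := by
  classical
  induction t with
  | var i => exact ⟨(Pi.single i 1, 0), fun a b => by simp [eval_single]⟩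
  | func F ts ih =>
    cases F with
    | add =>
      choose f hf using ih
      refine ⟨f 0 + f 1, fun a b => ?_⟩
      rw [map_add, map_add, ← (hf 0 a b).1, ← (hf 1 a b).1, ← (hf 0 a b).2, ← (hf 1 a b).2]
      exact ⟨rfl, rfl⟩

/-- Agreement at a sufficiently high level preserves formulas in the language `{+, ≤}`. -/
theorem exists_agree_realize_iff_addLeLang {n : ℕ} (φ : addLeLang.BoundedFormula α n) :
    ∃ F m, ∀ (v : α → G) (xs : Fin n → G) (w : α → H) (ys : Fin n → H),
      Agree A B F m (Sum.elim v xs) (Sum.elim w ys) → (φ.Realize v xs ↔ φ.Realize w ys) := by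
  refine exists_agree_realize_iff A B addLeLang (exists_form_addLeLang A B) ?_ φ
  intro n k R ts
  cases R with
  | le =>
    obtain ⟨f₀, h₀⟩ := exists_form_addLeLang A B (ts 0)
    obtain ⟨f₁, h₁⟩ := exists_form_addLeLang A B (ts 1)
    refine ⟨{f₁ - f₀}, 1, fun a b h => ?_⟩
    have e := h.1 (f₁ - f₀) (by simp)
    rw [map_sub, map_sub, sub_nonneg, sub_nonneg, ← (h₀ a b).1, ← (h₁ a b).1, ← (h₀ a b).2,
      ← (h₁ a b).2] at e
    exact e

theorem exists_form_addOneLang {G H : Type} [AddCommGroup G] [LinearOrder G] [AddCommGroup H]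
    [LinearOrder H] (A : ZGroupData G) (B : ZGroupData H) {ι : Type} [Fintype ι] (t : addOneLang.Term ι) :
    letI : addOneLang.Structure G := addOneStructure A.one
    letI : addOneLang.Structure H := addOneStructure B.one
    ∃ f, ∀ (a : ι → G) (b : ι → H), t.realize a = A.eval a f ∧ t.realize b = B.eval b f := by
  classical
  let _ : addOneLang.Structure G := addOneStructure A.one
  let _ : addOneLang.Structure H := addOneStructure B.one
  induction t with
  | var i => exact ⟨(Pi.single i 1, 0), fun a b => by simp [eval_single]⟩
  | func F ts ih =>
    cases F with
    | add =>
      choose f hf using ih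
      refine ⟨f 0 + f 1, fun a b => ?_⟩
      rw [map_add, map_add, ← (hf 0 a b).1, ← (hf 1 a b).1, ← (hf 0 a b).2, ← (hf 1 a b).2]
      exact ⟨rfl, rfl⟩
    | one =>
      refine ⟨(0, 1), fun a b => ?_⟩
      rw [eval_const, eval_const, one_smul, one_smul]
      exact ⟨rfl, rfl⟩

/-- Agreement at a sufficiently high level preserves formulas in the language `{+, 1}`. -/
theorem exists_agree_realize_iff_addOneLang {n : ℕ} (φ : addOneLang.BoundedFormula α n) :
    letI : addOneLang.Structure G := addOneStructure A.one
    letI : addOneLang.Structure H := addOneStructure B.one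
    ∃ F m, ∀ (v : α → G) (xs : Fin n → G) (w : α → H) (ys : Fin n → H),
      Agree A B F m (Sum.elim v xs) (Sum.elim w ys) → (φ.Realize v xs ↔ φ.Realize w ys) := by
  let _ : addOneLang.Structure G := addOneStructure A.one
  let _ : addOneLang.Structure H := addOneStructure B.one
  exact exists_agree_realize_iff A B addOneLang (exists_form_addOneLang A B)
    (fun R _ => Empty.elim R) φ

end Formulas

section Consequences

open Language

variable {G : Type} [AddCommGroup G] [LinearOrder G] (A : ZGroupData G)

/-- The integers as a `ℤ`-group, with the canonical map to `ZHat`. -/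
def int : ZGroupData ℤ where
  one := 1
  res := Int.castAddHom ZHat
  least := ⟨Int.one_pos, fun _ h => h⟩
  res_one := Int.cast_one
  div n x h := by
    have h' : ((x : ℤ) : ZMod n) = 0 := by
      have h2 : ((x : ZHat).1 : ∀ n : ℕ+, ZMod n) n = (x : ZMod n) := by
        rw [show (x : ZHat).1 = (x : ∀ n : ℕ+, ZMod n) from ZHat.coe_intCast x]
        rfl
      rw [← h2]; exact h
    obtain ⟨y, rfl⟩ := (ZMod.intCast_zmod_eq_zero_iff_dvd _ _).1 h'
    exact ⟨y, by simp⟩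

theorem zsmul_one_nonneg_iff [IsOrderedAddMonoid G] (j : ℤ) : 0 ≤ j • A.one ↔ 0 ≤ j := by
  constructor
  · intro h
    by_contra hj
    have := neg_pos.2 (not_le.1 hj)
    have h2 : 0 < (-j) • A.one := zsmul_pos A.one_pos this
    rw [neg_smul, neg_pos] at h2
    exact absurd h h2.not_ge
  · exact zsmul_nonneg A.one_pos.le

/-- Completeness of the algebraic axioms of Presburger arithmetic. -/
theorem isOrderedZGroup [IsOrderedAddMonoid G] (A : ZGroupData G) : IsOrderedZGroup G := by
  rw [IsOrderedZGroup, Theory.model_iff]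
  intro φ hφ
  obtain ⟨F, m, h⟩ := exists_agree_realize_iff_addLeLang int A φ
  refine (h _ _ _ _ ⟨fun f _ => ?_, fun i => ?_⟩).1 (mem_completeTheory.1 hφ)
  · have h1 : f = (0, f.2) := Prod.ext (Subsingleton.elim _ _) rfl
    rw [h1, eval_const, eval_const, zsmul_one_nonneg_iff, zsmul_one_nonneg_iff]
  · exact isEmptyElim i

/-- The sign of an affine form at an infinite element is that of its leading coefficient. -/
theorem nonneg_add_iff [IsOrderedAddMonoid G] {d : G} (hd : ∀ j : ℤ, j • A.one < d) (c j : ℤ) :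
    0 ≤ c • d + j • A.one ↔ 0 < c ∨ c = 0 ∧ 0 ≤ j := by
  have hd0 : 0 < d := by simpa using hd 0
  rcases lt_trichotomy c 0 with hc | rfl | hc
  · refine iff_of_false (not_le.2 ?_) (by omega)
    have h1 : c • d ≤ -d := by
      have : (1 : ℤ) • d ≤ (-c) • d := zsmul_le_zsmul_left hd0.le (by omega)
      rw [neg_smul, one_smul] at this
      exact le_neg_of_le_neg this
    calc c • d + j • A.one ≤ -d + j • A.one := by gcongr
      _ < -d + d := by gcongr; exact hd j
      _ = 0 := by abel
  · simp [zsmul_one_nonneg_iff]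
  · refine iff_of_true ?_ (Or.inl hc)
    have h1 : (1 : ℤ) • d ≤ c • d := zsmul_le_zsmul_left hd0.le hc
    have h2 := hd (-j)
    rw [one_smul] at h1
    rw [neg_smul] at h2
    exact (neg_le_iff_add_nonneg.1 (h2.le.trans h1))

/-- An infinite element `d` without residues and its double have the same type. -/
theorem not_isLeibnizian [IsOrderedAddMonoid G] {d : G} (hd : ∀ j : ℤ, j • A.one < d) (hres : A.res d = 0) :
    ¬ IsLeibnizian addLeLang G := by
  intro hL
  have hd0 : 0 < d := by simpa using hd 0
  have hdd : ∀ j : ℤ, j • A.one < d + d := fun j => (hd j).trans (lt_add_of_pos_left _ hd0)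
  obtain ⟨φ, h1, h2⟩ := hL d (d + d) (lt_add_of_pos_left _ hd0).ne
  obtain ⟨F, m, h⟩ := exists_agree_realize_iff_addLeLang A A φ
  refine h2 ((h (fun _ => d) default (fun _ => d + d) default ⟨fun f _ => ?_, ?_⟩).1 h1)
  · simp only [eval_apply, Fintype.sum_sum_type, Sum.elim_inl, Finset.univ_unique,
      Finset.sum_singleton, Finset.univ_eq_empty, Finset.sum_empty, add_zero]
    rw [nonneg_add_iff A hd, nonneg_add_iff A hdd]
  · have hm : A.mod m d = 0 := by
      change (A.res d).1 m = 0
      rw [hres]; rfl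
    rintro (i | i)
    · simp [hm]
    · exact i.elim0

/-- The residue map is determined by its value at `one`. -/
theorem isResidueMap : IsResidueMap A.one A.res := by
  refine ⟨A.res_one, fun res' h => AddMonoidHom.ext fun x => Subtype.ext (funext fun n => ?_)⟩
  obtain ⟨y, r, -, rfl⟩ := A.exists_eq_nsmul_add n x
  have key : ∀ ρ : G →+ ZHat, ρ A.one = 1 → (ρ ((n : ℕ) • y + r • A.one)).1 n = r := by
    intro ρ hρ
    rw [map_add, map_nsmul, map_nsmul, hρ]
    change (n : ℕ) • (ρ y).1 n + r • (1 : ZMod n) = r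
    simp
  rw [key res' h, key A.res A.res_one]

end Consequences

/-! ### Separating elements by their residues -/

section Leibnizian

open Language

/-- The `(k + 1)`-fold sum of a term with itself. -/
def succNSMul {𝓛 : FirstOrder.Language.{0, 0}} {α : Type} (add : 𝓛.Functions 2) (t : 𝓛.Term α) :
    ℕ → 𝓛.Term α
  | 0 => t
  | k + 1 => add.apply₂ (succNSMul add t k) t

theorem realize_succNSMul {𝓛 : FirstOrder.Language.{0, 0}} {α G : Type} [AddCommGroup G] [𝓛.Structure G]
    (add : 𝓛.Functions 2) (hadd : ∀ x y : G, Structure.funMap add ![x, y] = x + y)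
    (t : 𝓛.Term α) (k : ℕ) (v : α → G) :
    (succNSMul add t k).realize v = (k + 1) • t.realize v := by
  induction k with
  | zero => simp [succNSMul]
  | succ k ih =>
    rw [succNSMul, Term.realize_functions_apply₂, hadd, ih, ← succ_nsmul]

variable {G : Type} [AddCommGroup G] [LinearOrder G] (A : ZGroupData G)

theorem exists_eq_iff_mod_eq (k r : ℕ) (x : G) :
    (∃ y, x = (k + 1) • y + (r + 1) • A.one) ↔ A.mod k.succPNat x = (r + 1 : ℕ) := by
  constructor
  · rintro ⟨y, rfl⟩
    have h : ((k + 1 : ℕ) : ZMod (k.succPNat : ℕ)) = 0 := ZMod.natCast_self _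
    rw [map_add, map_nsmul, map_nsmul, nsmul_eq_mul, h, zero_mul, mod_one, zero_add, nsmul_one]
  · intro h
    obtain ⟨y, hy⟩ := A.exists_of_mod_eq_zero (n := k.succPNat) (x := x - (r + 1) • A.one)
      (by rw [map_sub, h, map_nsmul, mod_one, nsmul_one, sub_self])
    exact ⟨y, by rw [← Nat.succ_eq_add_one k, ← Nat.succPNat_coe, hy]; abel⟩

theorem exists_separating_residue (hA : Function.Injective A.res) {a b : G} (hab : a ≠ b) :
    ∃ k r : ℕ, A.mod k.succPNat a = (r + 1 : ℕ) ∧ A.mod k.succPNat b ≠ (r + 1 : ℕ) := by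
  have h1 : (A.res a).1 ≠ (A.res b).1 := fun h => hab (hA (Subtype.ext h))
  obtain ⟨n, hn⟩ := Function.ne_iff.1 h1
  obtain ⟨k, rfl⟩ : ∃ k : ℕ, n = k.succPNat := ⟨n.natPred, by simp⟩
  have h2 : A.mod k.succPNat a = ((A.mod k.succPNat a - 1).val + 1 : ℕ) := by
    rw [Nat.cast_add, ZMod.natCast_zmod_val, Nat.cast_one, sub_add_cancel]
  exact ⟨k, _, h2, fun h => hn (h2.trans h.symm)⟩

/-- The symbol `+` of the language `{+, 1}`. -/
def addOneAdd : addOneLang.Functions 2 := AddOneFunc.add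

/-- The symbol `1` of the language `{+, 1}`. -/
def addOneOne : addOneLang.Constants := AddOneFunc.one

/-- The symbol `+` of the language `{+, ≤}`. -/
def addLeAdd : addLeLang.Functions 2 := AddLeFunc.add

/-- The symbol `≤` of the language `{+, ≤}`. -/
def addLeLe : addLeLang.Relations 2 := AddLeRel.le

/-- The formula of the language `{+, 1}` expressing that `x` has residue `r + 1` modulo
`k + 1`. -/
def residueFormula (k r : ℕ) : addOneLang.Formula (Fin 1) :=
  BoundedFormula.ex ((Term.var (Sum.inl 0) : addOneLang.Term (Fin 1 ⊕ Fin 1)).bdEqual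
    (addOneAdd.apply₂
      (succNSMul addOneAdd (Term.var (Sum.inr 0)) k)
      (succNSMul addOneAdd
        (Constants.term addOneOne) r)))

theorem realize_residueFormula (k r : ℕ) (x : G) :
    letI : addOneLang.Structure G := addOneStructure A.one
    (residueFormula k r).Realize (fun _ => x) ↔ A.mod k.succPNat x = (r + 1 : ℕ) := by
  let _ : addOneLang.Structure G := addOneStructure A.one
  rw [← exists_eq_iff_mod_eq]
  have hadd : ∀ x y : G, Structure.funMap addOneAdd ![x, y] = x + y :=
    fun _ _ => rfl
  rw [residueFormula, Formula.Realize, BoundedFormula.realize_ex]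
  refine exists_congr fun y => ?_
  rw [BoundedFormula.realize_bdEqual, Term.realize_functions_apply₂, hadd,
    realize_succNSMul _ hadd, realize_succNSMul _ hadd]
  exact Iff.rfl

/-- The formula of the language `{+, ≤}` expressing that `x` has residue `r + 1` modulo `k + 1`,
where the element `1` is defined as the least positive one; positivity of `z` is expressed by
the failure of `z + z ≤ z`. -/
def orderedResidueFormula (k r : ℕ) : addLeLang.Formula (Fin 1) :=
  BoundedFormula.ex
    ((∼ (addLeLe.boundedFormula₂
        (addLeAdd.apply₂
          (Term.var (Sum.inr 0)) (Term.var (Sum.inr 0))) (Term.var (Sum.inr 0))) ⊓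
      BoundedFormula.all
        (addLeLe.boundedFormula₂
          (addLeAdd.apply₂
            (Term.var (Sum.inr 1)) (Term.var (Sum.inr 1))) (Term.var (Sum.inr 1)) ⊔
          addLeLe.boundedFormula₂
            (Term.var (Sum.inr 0)) (Term.var (Sum.inr 1)))) ⊓
      BoundedFormula.ex ((Term.var (Sum.inl 0) : addLeLang.Term (Fin 1 ⊕ Fin 2)).bdEqual
        (addLeAdd.apply₂
          (succNSMul addLeAdd (Term.var (Sum.inr 1)) k)
          (succNSMul addLeAdd (Term.var (Sum.inr 0)) r))))

theorem realize_orderedResidueFormula [IsOrderedAddMonoid G] (k r : ℕ) (x : G) :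
    (orderedResidueFormula k r).Realize (fun _ => x) ↔ A.mod k.succPNat x = (r + 1 : ℕ) := by
  rw [← exists_eq_iff_mod_eq]
  have hadd : ∀ x y : G, Structure.funMap addLeAdd ![x, y] = x + y :=
    fun _ _ => rfl
  have hle : ∀ x y : G, Structure.RelMap addLeLe ![x, y] ↔ x ≤ y :=
    fun _ _ => Iff.rfl
  have key : (orderedResidueFormula k r).Realize (fun _ => x) ↔
      ∃ o : G, (¬ (o + o ≤ o) ∧ ∀ z, z + z ≤ z ∨ o ≤ z) ∧
        ∃ y, x = (k + 1) • y + (r + 1) • o := by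
    rw [orderedResidueFormula, Formula.Realize, BoundedFormula.realize_ex]
    refine exists_congr fun o => ?_
    simp only [BoundedFormula.realize_inf, BoundedFormula.realize_not, BoundedFormula.realize_all,
      BoundedFormula.realize_sup, BoundedFormula.realize_ex, BoundedFormula.realize_rel₂,
      BoundedFormula.realize_bdEqual, Term.realize_functions_apply₂, hadd, hle,
      realize_succNSMul _ hadd]
    exact Iff.rfl
  rw [key]
  constructor
  · rintro ⟨o, ⟨h1, h2⟩, h3⟩
    have ho : 0 < o := by simpa using h1
    have h4 : o ≤ A.one := (h2 A.one).resolve_left (by simpa using A.one_pos)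
    rwa [← h4.antisymm (A.one_le ho)]
  · refine fun h => ⟨A.one, ⟨by simpa using A.one_pos, fun z => ?_⟩, h⟩
    by_cases hz : 0 < z
    · exact Or.inr (A.one_le hz)
    · exact Or.inl (by simpa using hz)

theorem isLeibnizian [IsOrderedAddMonoid G] (hA : Function.Injective A.res) :
    IsLeibnizian addLeLang G := by
  intro a b hab
  obtain ⟨k, r, ha, hb⟩ := A.exists_separating_residue hA hab
  exact ⟨orderedResidueFormula k r, (A.realize_orderedResidueFormula k r a).2 ha,
    fun h => hb ((A.realize_orderedResidueFormula k r b).1 h)⟩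

/-- A subgroup `L` which is itself a `ℤ`-group with the same `1` is an elementary substructure in
the language `{+, 1}` by the Tarski–Vaught test, the witnesses being provided by the back-and-forth
between `G` and `L`. -/
theorem isLeibnizianZSubgroup [IsOrderedAddMonoid G] (L : AddSubgroup G) (hone : A.one ∈ L)
    (hdiv : ∀ (n : ℕ+) (x : G), x ∈ L → (A.res x).1 n = 0 → ∃ y ∈ L, (n : ℕ) • y = x)
    (hinj : ∀ x ∈ L, A.res x = 0 → x = 0) : IsLeibnizianZSubgroup A.one L := by
  let B : ZGroupData L :=
    { one := ⟨A.one, hone⟩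
      res := A.res.comp L.subtype
      least := ⟨A.one_pos, fun x hx => A.one_le (x := x.1) hx⟩
      res_one := A.res_one
      div := fun n x hx => by
        obtain ⟨y, hy, h⟩ := hdiv n x x.2 hx
        exact ⟨⟨y, hy⟩, Subtype.ext h⟩ }
  let _ : addOneLang.Structure G := addOneStructure A.one
  let S : addOneLang.Substructure G :=
    { carrier := L
      fun_mem := fun {n} f x hx => by
        cases f with
        | add => exact L.add_mem (hx 0) (hx 1)
        | one => exact hone }
  have heval : ∀ {ι : Type} [Fintype ι] (b : ι → L) f,
      ((B.eval b f : L) : G) = A.eval (fun i => (b i : G)) f := by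
    intro ι _ b f
    simp [eval_apply, B]
  have hS : S.IsElementary := by
    refine S.isElementary_of_exists fun n φ x a hφ => ?_
    obtain ⟨F, m, h⟩ := exists_agree_realize_iff_addOneLang A A φ
    obtain ⟨F', m', h'⟩ := exists_agree_snoc (A := A) (B := B) (α := Empty) F m
    have hsub : ∀ (xs : Fin n → L), Agree A B F' m'
        (Sum.elim (default : Empty → G) (fun i => (xs i : G))) (Sum.elim default xs) := by
      refine fun xs => ⟨fun f _ => ?_, ?_⟩
      · rw [← Subtype.coe_le_coe, heval]
        have : (fun i => ((Sum.elim (default : Empty → L) xs i : L) : G)) =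
            Sum.elim default (fun i => (xs i : G)) := by
          ext (i | i)
          · exact i.elim
          · rfl
        rw [this]; rfl
      · rintro (i | i)
        · exact i.elim
        · rfl
    obtain ⟨y, hy⟩ := h' _ _ _ _ (hsub x) a
    refine ⟨y, (h _ _ _ _ ⟨fun f hf => ?_, fun i => ?_⟩).1 hφ⟩
    · refine (hy.1 f hf).trans ?_
      rw [← Subtype.coe_le_coe, heval]
      have : (fun i => ((Sum.elim (default : Empty → L) (Fin.snoc x y) i : L) : G)) =
          Sum.elim default (Fin.snoc ((↑) ∘ x) (y : G)) := by
        ext (i | i)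
        · exact i.elim
        · induction i using Fin.lastCases with
          | last => simp
          | cast i => simp
      rw [this]; rfl
    · refine (hy.2 i).trans ?_
      rcases i with i | i
      · exact i.elim
      · induction i using Fin.lastCases with
        | last => simp; rfl
        | cast i => simp; rfl
  refine ⟨⟨S, hS⟩, rfl, fun a b hab => ?_⟩
  have hadd : ∀ x y : L, ((x + y : L) : G) = x + y := fun _ _ => rfl
  have hBinj : Function.Injective B.res := (injective_iff_map_eq_zero _).2 fun x hx =>
    Subtype.ext (hinj x x.2 hx)
  obtain ⟨k, r, ha, hb⟩ := B.exists_separating_residue hBinj (a := a) (b := b) hab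
  refine ⟨residueFormula k r, ?_, fun h => ?_⟩
  · rw [← hS]
    exact (A.realize_residueFormula k r a).2 ha
  · rw [← hS] at h
    exact hb ((A.realize_residueFormula k r b).1 h)

end Leibnizian

end ZGroupData

/-! ### The profinite integers -/

namespace ZHat

theorem exists_nsmul_eq {n : ℕ+} {x : ZHat} (h : x.1 n = 0) : ∃ y : ZHat, (n : ℕ) • y = x := by
  have hdvd (m : ℕ+) : (n : ℕ) ∣ (x.1 (n * m)).val := by
    have h1 := ZHat.cast_apply x (m := n) (n := n * m) (by simp)
    rwa [h, ← ZMod.natCast_zmod_val (x.1 (n * m)), map_natCast, ZMod.natCast_eq_zero_iff] at h1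
  have hmul (m : ℕ+) : (n : ℕ) * ((x.1 (n * m)).val / n) = (x.1 (n * m)).val :=
    Nat.mul_div_cancel' (hdvd m)
  refine ⟨⟨fun m => ((x.1 (n * m)).val / n : ℕ), fun m k hmk => ?_⟩,
    Subtype.ext (funext fun m => ?_)⟩
  · rw [map_natCast, ZMod.natCast_eq_natCast_iff]
    refine Nat.ModEq.mul_left_cancel' n.ne_zero ?_
    rw [hmul, hmul]
    have hd : ((n * m : ℕ+) : ℕ) ∣ (n * k : ℕ+) := by
      simpa using Nat.mul_dvd_mul_left (n : ℕ) hmk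
    have h2 := ZHat.cast_apply x hd
    rw [← ZMod.natCast_zmod_val (x.1 (n * k)), map_natCast,
      ← ZMod.natCast_zmod_val (x.1 (n * m)), ZMod.natCast_eq_natCast_iff] at h2
    simpa using h2
  · change (n : ℕ) • (((x.1 (n * m)).val / n : ℕ) : ZMod m) = x.1 m
    have hd : (m : ℕ) ∣ (n * m : ℕ+) := by simp
    rw [nsmul_eq_mul, ← Nat.cast_mul, hmul, ← ZHat.cast_apply x hd,
      ← ZMod.natCast_zmod_val (x.1 (n * m)), map_natCast, ZMod.natCast_zmod_val]

theorem eq_zero_of_nsmul_eq_zero {n : ℕ+} {x : ZHat} (h : (n : ℕ) • x = 0) : x = 0 :=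
  Subtype.ext (funext fun m => apply_eq_zero_of_nsmul (k := n) (by rw [h]; rfl))

instance : IsAddTorsionFree ZHat where
  nsmul_right_injective n hn x y h := by
    have h1 : ((⟨n, Nat.pos_of_ne_zero hn⟩ : ℕ+) : ℕ) • (x - y) = 0 := by
      rw [smul_sub]
      exact sub_eq_zero.2 h
    exact sub_eq_zero.1 (eq_zero_of_nsmul_eq_zero h1)

theorem intCast_apply (k : ℤ) (n : ℕ+) : (k : ZHat).1 n = k := by
  rw [show (k : ZHat).1 = (k : ∀ n : ℕ+, ZMod n) from ZHat.coe_intCast k]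
  rfl

/-- `ℤ` is pure in `ZHat`. -/
theorem exists_intCast_of_nsmul {n : ℕ+} {x : ZHat} {k : ℤ} (h : (n : ℕ) • x = (k : ZHat)) :
    ∃ j : ℤ, x = j := by
  have h1 : ((k : ℤ) : ZMod n) = 0 := by
    rw [← intCast_apply, ← h]
    change (n : ℕ) • x.1 n = 0
    simp
  obtain ⟨j, rfl⟩ := (ZMod.intCast_zmod_eq_zero_iff_dvd _ _).1 h1
  refine ⟨j, sub_eq_zero.1 (eq_zero_of_nsmul_eq_zero (n := n) ?_)⟩
  rw [smul_sub, h]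
  simp

/-- Partial sums of the factorial series with digits `b`. The series starts with `1!` because a digit
at `0!` would not be visible modulo `1!`. -/
def digitSum (b : ℕ → Bool) (n : ℕ) : ℕ :=
  ∑ k ∈ Finset.range n, if b k then (k + 1).factorial else 0

theorem digitSum_modEq (b : ℕ → Bool) {m i n : ℕ} (hm : m ∣ (i + 1).factorial) (hin : i ≤ n) :
    digitSum b n ≡ digitSum b i [MOD m] := by
  induction n, hin using Nat.le_induction with
  | base => rfl
  | succ n hn ih =>
    rw [digitSum, Finset.sum_range_succ]
    refine (Nat.ModEq.add ih (b := _) (d := 0) ((Nat.modEq_zero_iff_dvd).2 ?_))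
    split_ifs
    · exact hm.trans (Nat.factorial_dvd_factorial (by omega))
    · exact dvd_zero _

/-- The profinite integer `∑ b k (k + 1)!`. -/
def ofDigits (b : ℕ → Bool) : ZHat :=
  ⟨fun n => (digitSum b n : ZMod n), fun m n h => by
    rw [map_natCast, ZMod.natCast_eq_natCast_iff]
    exact digitSum_modEq b (Nat.dvd_factorial m.pos (by omega)) (Nat.le_of_dvd n.pos h)⟩

theorem ofDigits_injective : Function.Injective ofDigits := by
  intro b c h
  by_contra hne
  obtain ⟨k, hk, hmin⟩ : ∃ k, b k ≠ c k ∧ ∀ j < k, b j = c j := by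
    have hex : ∃ k, b k ≠ c k := Function.ne_iff.1 hne
    classical
    exact ⟨Nat.find hex, Nat.find_spec hex, fun j hj => not_not.1 (Nat.find_min hex hj)⟩
  have h1 : (digitSum b (k + 2).factorial : ZMod (k + 2).factorial) =
      digitSum c (k + 2).factorial :=
    congrFun (congrArg Subtype.val h) ⟨(k + 2).factorial, Nat.factorial_pos _⟩
  rw [ZMod.natCast_eq_natCast_iff] at h1
  -- modulo `(k + 2)!` only the digits up to the first difference `k` matter
  have hle : k + 1 ≤ (k + 2).factorial := (Nat.le_succ _).trans (Nat.self_le_factorial _)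
  have h2 := ((digitSum_modEq b dvd_rfl hle).symm.trans h1).trans (digitSum_modEq c dvd_rfl hle)
  have h3 : digitSum b k = digitSum c k :=
    Finset.sum_congr rfl fun j hj => by rw [hmin j (Finset.mem_range.1 hj)]
  rw [digitSum, digitSum, Finset.sum_range_succ, Finset.sum_range_succ, ← digitSum, ← digitSum,
    h3] at h2
  have h4 := Nat.ModEq.add_left_cancel' _ h2
  have hlt : (k + 1).factorial < (k + 2).factorial :=
    (Nat.factorial_lt (Nat.succ_pos k)).2 (Nat.lt_succ_self _)
  have hpos := Nat.factorial_pos (k + 1)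
  have h5 : ¬ (0 ≡ (k + 1).factorial [MOD (k + 2).factorial]) := fun h =>
    hpos.ne (Nat.ModEq.eq_of_lt_of_lt h (hpos.trans hlt) hlt)
  cases hb : b k <;> cases hc : c k <;> simp [hb, hc] at hk h4
  · exact h5 h4
  · exact h5 h4.symm

theorem two_power_aleph0_le : 2 ^ ℵ₀ ≤ #ZHat := by
  have h := Cardinal.mk_le_of_injective ofDigits_injective
  simpa using h

theorem mk_le_two_power_aleph0 : #ZHat ≤ 2 ^ ℵ₀ := by
  have h : #ZHat ≤ #(∀ n : ℕ+, ZMod n) := Cardinal.mk_le_of_injective Subtype.val_injective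
  refine h.trans ?_
  rw [mk_pi]
  refine (Cardinal.prod_le_prod (g := fun _ : ℕ+ => ℵ₀) _ fun n => ?_).trans ?_
  · exact (Cardinal.lt_aleph0_of_finite (ZMod n)).le
  · simp

end ZHat

theorem mk_finsupp_rat_le (I : Type) : #(I →₀ ℚ) ≤ max #I ℵ₀ := by
  rcases isEmpty_or_nonempty I with h | h
  · exact (Cardinal.mk_le_aleph0 (α := I →₀ ℚ)).trans (le_max_right _ _)
  · rw [mk_finsupp_of_infinite']; simp

/-- The quotient `ZHat / ℤ` embeds, as an essential subgroup, in a rational vector space of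
dimension continuum. The map `ψ` is this embedding in coordinates, and `τ` is a rational-valued
retraction onto `ℤ`. -/
theorem ZHat.exists_coordinates :
    ∃ (I : Type) (ψ : ZHat →+ (I →₀ ℚ)) (τ : ZHat →+ ℚ), #I = 2 ^ ℵ₀ ∧ ψ 1 = 0 ∧ τ 1 = 1 ∧
      (∀ x, ψ x = 0 → ∃ k : ℤ, x = k) ∧
      ∀ i, ∃ (x : ZHat) (n : ℕ+), ψ x = Finsupp.single i (n : ℚ) := by
  let V := DivisibleHull ZHat
  let j : ZHat →+ V := DivisibleHull.coeAddMonoidHom ZHat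
  have hj : Function.Injective j := DivisibleHull.coe_injective
  let U : Submodule ℚ V := Submodule.span ℚ {j 1}
  let b := Module.Basis.ofVectorSpace ℚ (V ⧸ U)
  let I := Module.Basis.ofVectorSpaceIndex ℚ (V ⧸ U)
  let ψ : ZHat →+ (I →₀ ℚ) := (b.repr.toLinearMap.comp U.mkQ).toAddMonoidHom.comp j
  obtain ⟨g, hg⟩ := (LinearMap.toSpanSingleton ℚ V (j 1)).exists_leftInverse_of_injective
    (LinearMap.ker_toSpanSingleton ℚ
      (by rw [Ne, map_eq_zero_iff j hj]; exact fun h => by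
            have := congrFun (congrArg Subtype.val h) 2
            exact absurd this (by decide)))
  let τ : ZHat →+ ℚ := g.toAddMonoidHom.comp j
  have hτ : τ 1 = 1 := by
    have h1 : g (j 1) = 1 := by simpa using LinearMap.congr_fun hg 1
    exact h1
  have hker : ∀ x, ψ x = 0 → ∃ k : ℤ, x = k := by
    intro x hx
    have h1 : b.repr (U.mkQ (j x)) = 0 := hx
    rw [LinearEquiv.map_eq_zero_iff, Submodule.mkQ_apply, Submodule.Quotient.mk_eq_zero,
      Submodule.mem_span_singleton] at h1
    obtain ⟨q, hq⟩ := h1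
    refine exists_intCast_of_nsmul (n := ⟨q.den, q.pos⟩) (k := q.num) (hj ?_)
    rw [map_nsmul, ← hq, ← zsmul_one, map_zsmul, ← Nat.cast_smul_eq_nsmul ℚ, smul_smul,
      ← Int.cast_smul_eq_zsmul ℚ]
    simp
  have hess : ∀ i : I, ∃ (x : ZHat) (n : ℕ+), ψ x = Finsupp.single i (n : ℚ) := by
    intro i
    obtain ⟨v, hv⟩ := U.mkQ_surjective (b i)
    obtain ⟨x, n, rfl⟩ : ∃ x n, v = DivisibleHull.mk x n :=
      DivisibleHull.ind (fun x n => ⟨x, n, rfl⟩) v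
    refine ⟨x, n, ?_⟩
    have h1 : j x = (n : ℕ) • DivisibleHull.mk x n := by
      rw [DivisibleHull.nsmul_mk]
      exact DivisibleHull.mk_eq_mk_iff_smul_eq_smul.2 (by simp)
    change b.repr (U.mkQ (j x)) = _
    rw [h1, map_nsmul, hv, map_nsmul, b.repr_self, Finsupp.smul_single, nsmul_one]
  have hI : #I = 2 ^ ℵ₀ := by
    have hinj : Function.Injective (fun x => (ψ x, τ x)) := by
      let f : ZHat →+ (I →₀ ℚ) × ℚ := ψ.prod τ
      refine (injective_iff_map_eq_zero f).2 fun x hx => ?_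
      obtain ⟨k, rfl⟩ := hker x (congrArg Prod.fst hx)
      have h2 : τ (k : ZHat) = 0 := congrArg Prod.snd hx
      rw [← zsmul_one, map_zsmul, hτ] at h2
      have h3 : k = 0 := by simpa using h2
      simp [h3]
    refine le_antisymm ?_ ?_
    · choose x n hx using hess
      refine (Cardinal.mk_le_of_injective (f := x) fun i i' h => ?_).trans mk_le_two_power_aleph0
      have h1 := (hx i).symm.trans ((congrArg ψ h).trans (hx i'))
      rcases Finsupp.single_eq_single_iff .. |>.1 h1 with h2 | h2
      · exact h2.1
      · exact absurd h2.1 (by simp)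
    · have h1 := two_power_aleph0_le.trans (Cardinal.mk_le_of_injective hinj)
      rw [mk_prod, lift_id, lift_id, mk_eq_aleph0 ℚ] at h1
      have h2 : 2 ^ ℵ₀ ≤ max #I ℵ₀ := h1.trans ((mul_le_mul_left (mk_finsupp_rat_le I) _).trans
        (by rw [Cardinal.mul_aleph0_eq (le_max_right _ _)]))
      exact (le_max_iff.1 h2).resolve_right (not_le.2 (cantor ℵ₀))
  refine ⟨I, ψ, τ, hI, ?_, hτ, hker, hess⟩
  change b.repr (U.mkQ (j 1)) = 0
  rw [LinearEquiv.map_eq_zero_iff, Submodule.mkQ_apply, Submodule.Quotient.mk_eq_zero]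
  exact Submodule.mem_span_singleton_self _

/-! ### Real numbers -/

theorem exists_algebraicIndependent_real (X : Type) (hX : #X ≤ 2 ^ ℵ₀) :
    ∃ z : X → ℝ, AlgebraicIndependent ℚ z := by
  obtain ⟨ι, x, hx⟩ := exists_isTranscendenceBasis' ℚ ℝ
  have h1 : #X ≤ #ι := by
    refine hX.trans ?_
    rcases isEmpty_or_nonempty ι with hι | hι
    · have halg : Algebra.IsAlgebraic ℚ ℝ := hx.isEmpty_iff_isAlgebraic.1 hι
      have h2 := Algebra.IsAlgebraic.cardinalMk_le_max ℚ ℝ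
      rw [mk_real, mk_eq_aleph0 ℚ, max_self] at h2
      exact absurd h2 (not_le.2 aleph0_lt_continuum)
    · have h2 := hx.lift_cardinalMk_eq_max_lift
      simp only [lift_id, mk_real, mk_eq_aleph0 ℚ] at h2
      rw [two_power_aleph0]
      by_contra hlt
      refine h2.not_gt (max_lt (max_lt aleph0_lt_continuum (not_le.1 hlt)) aleph0_lt_continuum)
  obtain ⟨e⟩ := h1
  exact ⟨x ∘ e, hx.1.comp e e.injective⟩

/-- A rational combination of one part of an algebraically independent family which lies in the
field generated by the other part is trivial. -/
theorem AlgebraicIndependent.eq_zero_of_linearCombination_mem_adjoin {I T : Type}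
    {z : I ⊕ T → ℝ} (hz : AlgebraicIndependent ℚ z) (q : I →₀ ℚ)
    (h : Finsupp.linearCombination ℚ (fun i => z (Sum.inl i)) q ∈
      IntermediateField.adjoin ℚ (Set.range fun t => z (Sum.inr t))) : q = 0 := by
  classical
  ext i
  by_contra hi
  rw [Finsupp.zero_apply] at hi
  let s : Set (I ⊕ T) := {Sum.inl i}ᶜ
  let E := IntermediateField.adjoin ℚ (z '' s)
  have hsub : ∀ x ∈ s, z x ∈ E := fun x hx =>
    IntermediateField.subset_adjoin _ _ (Set.mem_image_of_mem _ hx)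
  have hle : IntermediateField.adjoin ℚ (Set.range fun t => z (Sum.inr t)) ≤ E :=
    IntermediateField.adjoin_le_iff.2 (by rintro _ ⟨t, rfl⟩; exact hsub _ (by simp [s]))
  -- the combination can be solved for the `i`-th member, since its coefficient is nonzero
  have hmem : z (Sum.inl i) ∈ E := by
    have h1 := hle h
    rw [Finsupp.linearCombination_apply, Finsupp.sum,
      ← Finset.add_sum_erase _ _ (Finsupp.mem_support_iff.2 hi)] at h1
    have h2 : ∑ k ∈ q.support.erase i, q k • z (Sum.inl k) ∈ E := by
      refine sum_mem fun k hk => E.smul_mem (hsub _ ?_)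
      simpa [s] using Finset.ne_of_mem_erase hk
    have h3 := E.smul_mem (x := (q i)⁻¹) ((add_mem_cancel_right h2).1 h1)
    rwa [smul_smul, inv_mul_cancel₀ hi, one_smul] at h3
  refine hz.transcendental_adjoin (i := Sum.inl i) (s := s) (by simp [s]) ?_
  open scoped IntermediateField.algebraAdjoinAdjoin in
  exact (Algebra.IsAlgebraic.isAlgebraic (R := Algebra.adjoin ℚ (z '' s))
    (⟨z (Sum.inl i), hmem⟩ : E)).algebraMap (A := ℝ)

/-! ### Groups of the form `L × D` -/

/-- A pure subgroup `L` of `ZHat` with a real-valued map `σ` for which the preimage of the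
rational subspace `D` is `ℤ`, and a rational-valued map `τ` which is the identity on `ℤ`, give a `ℤ`-group `L × D`,
ordered lexicographically by `σ l + d` and `τ l`. -/
theorem exists_zGroupData_prod (L : AddSubgroup ZHat) (D : Submodule ℚ ℝ) (σ : L →+ ℝ)
    (τ : L →+ ℚ) (h1 : (1 : ZHat) ∈ L) (hσ1 : σ ⟨1, h1⟩ = 0) (hτ1 : τ ⟨1, h1⟩ = 1)
    (hσ : ∀ l : L, σ l ∈ D → ∃ k : ℤ, l = k • ⟨1, h1⟩)
    (hL : ∀ (n : ℕ+) (x : ZHat), (n : ℕ) • x ∈ L → x ∈ L) :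
    ∃ (_ : LinearOrder (L × D)) (_ : IsOrderedAddMonoid (L × D)) (A : ZGroupData (L × D)),
      A.one = (⟨1, h1⟩, 0) ∧ (∀ x, A.res x = x.1) ∧
      ∀ x : L × D, 0 < x ↔ 0 < σ x.1 + x.2 ∨ σ x.1 + x.2 = 0 ∧ 0 < τ x.1 := by
  let f : L × D →+ Lex (ℝ × ℚ) :=
    { toFun := fun x => toLex (σ x.1 + x.2, τ x.1)
      map_zero' := by simp
      map_add' := fun x y => by
        rw [← toLex_add]
        congr 1
        ext
        · simp; ring
        · simp }
  have hf0 : ∀ x : L × D, σ x.1 + x.2 = 0 → ∃ k : ℤ, x = k • (⟨1, h1⟩, 0) ∧ τ x.1 = k := by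
    intro x hx
    obtain ⟨k, hk⟩ := hσ x.1 (by
      rw [eq_neg_of_add_eq_zero_left hx]; exact D.neg_mem x.2.2)
    have h2 : σ x.1 = 0 := by rw [hk, map_zsmul, hσ1, smul_zero]
    refine ⟨k, Prod.ext hk ?_, by rw [hk, map_zsmul, hτ1]; simp⟩
    rw [h2, zero_add] at hx
    simpa using hx
  have hfinj : Function.Injective f := by
    refine (injective_iff_map_eq_zero f).2 fun x hx => ?_
    have h2 : σ x.1 + x.2 = 0 := congrArg (fun y => (ofLex y).1) hx
    have h3 : τ x.1 = 0 := congrArg (fun y => (ofLex y).2) hx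
    obtain ⟨k, rfl, hk⟩ := hf0 x h2
    rw [h3] at hk
    have : k = 0 := by exact_mod_cast hk.symm
    rw [this, zero_smul]
  let _ : LinearOrder (L × D) := LinearOrder.lift' f hfinj
  have hord : IsOrderedAddMonoid (L × D) :=
    Function.Injective.isOrderedAddMonoid f (map_add f) Iff.rfl
  have hpos : ∀ x : L × D, 0 < x ↔ 0 < σ x.1 + x.2 ∨ σ x.1 + x.2 = 0 ∧ 0 < τ x.1 := by
    intro x
    have h2 : 0 < x ↔ f 0 < f x := Iff.rfl
    rw [h2, map_zero, Prod.Lex.lt_iff]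
    simp [f, eq_comm]
  refine ⟨inferInstance, hord,
    { one := (⟨1, h1⟩, 0)
      res := L.subtype.comp (AddMonoidHom.fst L D)
      least := ⟨(hpos _).2 (Or.inr ⟨by simp [hσ1], by simp [hτ1]⟩), fun x hx => ?_⟩
      res_one := rfl
      div := fun n x hx => ?_ }, rfl, fun _ => rfl, hpos⟩
  · rw [← sub_nonneg]
    rcases (hpos x).1 hx with h2 | ⟨h2, h3⟩
    · exact ((hpos _).2 (Or.inl (by
        rw [Prod.fst_sub, Prod.snd_sub, map_sub, hσ1]; simpa using h2))).le
    · obtain ⟨k, rfl, hk⟩ := hf0 x h2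
      rw [hk] at h3
      have h4 : (1 : ℤ) ≤ k := by exact_mod_cast h3
      have h6 : 0 ≤ ((⟨1, h1⟩, 0) : L × D) :=
        ((hpos _).2 (Or.inr ⟨by simp [hσ1], by simp [hτ1]⟩)).le
      have h7 := zsmul_le_zsmul_left h6 h4
      rw [one_smul] at h7
      exact sub_nonneg.2 h7
  · obtain ⟨y, hy⟩ := ZHat.exists_nsmul_eq (n := n) (x := x.1) hx
    refine ⟨(⟨y, hL n y (hy ▸ x.1.2)⟩, ((n : ℚ)⁻¹) • x.2), Prod.ext (Subtype.ext hy) ?_⟩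
    rw [Prod.smul_snd, ← Nat.cast_smul_eq_nsmul ℚ, smul_smul, mul_inv_cancel₀ (by simp), one_smul]

/-- A monotone endomorphism `e` acts on a monotone real-valued homomorphism `ρ` as multiplication
by the constant `ρ (e g) / ρ g`: rational cuts of `ρ x / ρ g` are comparisons between multiples of
`x` and `g`, which `e` preserves. -/
theorem map_mul_map_eq {G : Type} [AddCommGroup G] [LinearOrder G] [IsOrderedAddMonoid G]
    (ρ : G →+ ℝ) (hρ : ∀ x, 0 ≤ x → 0 ≤ ρ x) (e : G →+ G) (he : ∀ x, 0 ≤ x → 0 ≤ e x)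
    {g : G} (hg : 0 < ρ g) (x : G) : ρ (e x) * ρ g = ρ (e g) * ρ x := by
  have hpos : ∀ y, 0 < ρ y → 0 ≤ ρ (e y) := fun y hy => hρ _ (he _ (by
    by_contra hn
    have := hρ (-y) (neg_nonneg.2 (not_le.1 hn).le)
    rw [map_neg] at this
    linarith))
  have hg' := hpos g hg
  have key : ∀ x, ρ (e x) ≤ ρ x / ρ g * ρ (e g) := by
    intro x
    have hq : ∀ q : ℚ, ρ x / ρ g < q → ρ (e x) ≤ q * ρ (e g) := by
      intro q hq
      have hden : (0 : ℝ) < q.den := by exact_mod_cast q.pos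
      have h1 : 0 < ρ (q.num • g - q.den • x) := by
        rw [map_sub, map_zsmul, map_nsmul, sub_pos, nsmul_eq_mul, zsmul_eq_mul]
        rw [div_lt_iff₀ hg, Rat.cast_def, div_mul_eq_mul_div, lt_div_iff₀ hden] at hq
        linarith
      have h2 := hpos _ h1
      rw [map_sub, map_sub, map_zsmul, map_nsmul, map_zsmul, map_nsmul, sub_nonneg, nsmul_eq_mul,
        zsmul_eq_mul] at h2
      rw [Rat.cast_def, div_mul_eq_mul_div, le_div_iff₀ hden]
      linarith
    by_contra hlt
    rw [not_le] at hlt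
    -- if `ρ (e g) = 0`, any rational above `ρ x / ρ g` gives the bound
    rcases hg'.eq_or_lt with h0 | h0
    · obtain ⟨q, hq1⟩ := exists_rat_gt (ρ x / ρ g)
      have := hq q hq1
      rw [← h0, mul_zero] at this hlt
      linarith
    · rw [← lt_div_iff₀ h0] at hlt
      obtain ⟨q, hq1, hq2⟩ := exists_rat_btwn hlt
      have := hq q hq1
      rw [lt_div_iff₀ h0] at hq2
      linarith
  have h1 := key x
  have h2 := key (-x)
  simp only [map_neg, neg_div, neg_mul] at h2
  have h3 : ρ (e x) = ρ x / ρ g * ρ (e g) := by linarith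
  rw [h3]
  field_simp

/-- Leibnizian structures are rigid. -/
theorem IsLeibnizian.isRigid {𝓛 : FirstOrder.Language} {M : Type} [𝓛.Structure M]
    (h : IsLeibnizian 𝓛 M) : IsRigid 𝓛 M := by
  intro f x
  by_contra hne
  obtain ⟨φ, h1, h2⟩ := h _ _ hne
  have h3 := FirstOrder.Language.StrongHomClass.realize_formula f φ (v := fun _ => x)
  exact h2 (h3.1 h1)

namespace ZGroupData

variable {G : Type} [AddCommGroup G] [LinearOrder G] (A : ZGroupData G)

/-- An automorphism of the structure `(G, +, ≤)` as an isomorphism of ordered groups. -/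
def toOrderAddMonoidIso (f : addLeLang.Equiv G G) : G ≃+o G where
  toEquiv := f.toEquiv
  map_add' x y := by
    have h := f.map_fun (addLeAdd) ![x, y]
    exact h
  map_le_map_iff' {x y} := by
    have h := f.map_rel addLeLe ![x, y]
    exact h

theorem map_one_of_equiv (f : G ≃+o G) : f A.one = A.one := by
  have h : ∀ f : G ≃+o G, A.one ≤ f A.one := fun f => A.one_le (by
    have := (map_lt_map_iff f).2 A.one_pos
    rwa [map_zero] at this)
  refine le_antisymm ?_ (h f)
  have := (map_le_map_iff f).2 (h f.symm)
  simpa using this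

theorem res_of_equiv (f : G ≃+o G) (x : G) : A.res (f x) = A.res x := by
  have h := A.isResidueMap.2 (A.res.comp (f : G →+ G))
    (by simp [A.map_one_of_equiv f, A.res_one])
  exact DFunLike.congr_fun h x

/-- Rigidity of a `ℤ`-group with an archimedean quotient. An automorphism fixes residues, hence it
moves elements by elements of `ker res`, and it rescales `ρ` by a constant. If `ρ` maps `ker res`
into a field `F`, the constant lies in `F`, and it has to be `1` as soon as `ρ` takes a value
outside `F`. -/
theorem isRigid [IsOrderedAddMonoid G] (ρ : G →+ ℝ) (hρ : ∀ x, 0 ≤ x → 0 ≤ ρ x) (F : IntermediateField ℚ ℝ)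
    (hF : ∀ x, A.res x = 0 → ρ x ∈ F) (hinj : ∀ x, A.res x = 0 → ρ x = 0 → x = 0)
    (hd : ∃ d, A.res d = 0 ∧ 0 < ρ d) (hg : ∃ g, ρ g ∉ F) : IsRigid addLeLang G := by
  intro f x
  let e := toOrderAddMonoidIso f
  obtain ⟨d, hd0, hdpos⟩ := hd
  obtain ⟨g, hg⟩ := hg
  have hscale : ∀ x, ρ (e x) * ρ d = ρ (e d) * ρ x := map_mul_map_eq ρ hρ (e : G →+ G)
    (fun x hx => by
      have := (map_le_map_iff e).2 hx
      rwa [map_zero] at this) hdpos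
  have hsub : ∀ x, A.res (e x - x) = 0 := fun x => by rw [map_sub, A.res_of_equiv, sub_self]
  have hed : ρ (e d) = ρ d := by
    by_contra hne
    have h1 : ρ (e d) ∈ F := hF _ (by rw [A.res_of_equiv, hd0])
    have h2 : ρ (e g - g) ∈ F := hF _ (hsub g)
    have h3 : ρ g = ρ (e g - g) * ρ d / (ρ (e d) - ρ d) := by
      rw [eq_div_iff (sub_ne_zero.2 hne), map_sub]
      linarith [hscale g]
    exact hg (h3 ▸ F.div_mem (F.mul_mem h2 (hF d hd0)) (F.sub_mem h1 (hF d hd0)))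
  have hx := hscale x
  rw [hed, mul_comm (ρ d)] at hx
  have h4 : e x - x = 0 :=
    hinj _ (hsub x) (by rw [map_sub, mul_right_cancel₀ hdpos.ne' hx, sub_self])
  exact sub_eq_zero.1 h4

end ZGroupData

/-! ### Existence of the groups -/

theorem mk_finsupp_rat {I : Type} (h : ℵ₀ ≤ #I) : #(I →₀ ℚ) = #I := by
  have : Nonempty I := mk_ne_zero_iff.1 (aleph0_pos.trans_le h).ne'
  rw [mk_finsupp_of_infinite', mk_eq_aleph0 ℚ, max_eq_left h]

/-- The ingredients of the construction: a pure subgroup `L` of `ZHat` of cardinality `μ`, a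
subfield `F` of `ℝ` containing a rational subspace `D` of cardinality `κ`, and a map `σ : L → ℝ`
with kernel `ℤ` which is injective modulo `ℤ` even after reduction modulo `F`. The images of a basis
of `L / ℤ` and the generators of `F` form an algebraically independent family. -/
theorem exists_subgroup_subspace {κ μ : Cardinal.{0}} (hκ : ℵ₀ ≤ κ) (hκ' : κ ≤ 2 ^ ℵ₀)
    (hμ : ℵ₀ ≤ μ) (hμ' : μ ≤ 2 ^ ℵ₀) :
    ∃ (L : AddSubgroup ZHat) (D : Submodule ℚ ℝ) (F : IntermediateField ℚ ℝ) (σ : L →+ ℝ)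
      (τ : L →+ ℚ) (h1 : (1 : ZHat) ∈ L), #L = μ ∧ #D = κ ∧ (∀ x ∈ D, x ∈ F) ∧
      σ ⟨1, h1⟩ = 0 ∧ τ ⟨1, h1⟩ = 1 ∧ (∀ l : L, σ l ∈ F → ∃ k : ℤ, l = k • ⟨1, h1⟩) ∧
      (∀ (n : ℕ+) (x : ZHat), (n : ℕ) • x ∈ L → x ∈ L) ∧ ∃ l : L, σ l ∉ F := by
  obtain ⟨I, ψ, τ, hI, hψ1, hτ1, hψ, hess⟩ := ZHat.exists_coordinates
  obtain ⟨J, rfl⟩ := Cardinal.le_mk_iff_exists_set.1 (hI ▸ hμ')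
  induction κ using Cardinal.inductionOn with | _ T =>
  obtain ⟨z, hz⟩ := exists_algebraicIndependent_real (I ⊕ T) (by
    rw [mk_sum, lift_id, lift_id, hI]
    exact add_le_of_le (cantor ℵ₀).le le_rfl hκ')
  let L : AddSubgroup ZHat := (Finsupp.supported ℚ ℚ J).toAddSubgroup.comap ψ
  have hmemL : ∀ x, x ∈ L ↔ ψ x ∈ Finsupp.supported ℚ ℚ J := fun x => Iff.rfl
  have h1 : (1 : ZHat) ∈ L := by rw [hmemL, hψ1]; exact Submodule.zero_mem _
  let D : Submodule ℚ ℝ := Submodule.span ℚ (Set.range fun t => z (Sum.inr t))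
  let F := IntermediateField.adjoin ℚ (Set.range fun t => z (Sum.inr t))
  let ζ := Finsupp.linearCombination ℚ fun i => z (Sum.inl i)
  let σ : L →+ ℝ := (ζ.toAddMonoidHom.comp ψ).comp L.subtype
  have hσ : ∀ l : L, σ l ∈ F → ∃ k : ℤ, l = k • ⟨1, h1⟩ := by
    intro l hl
    obtain ⟨k, hk⟩ := hψ l (hz.eq_zero_of_linearCombination_mem_adjoin _ hl)
    exact ⟨k, Subtype.ext (by rw [hk]; simp)⟩
  choose x n hx using hess
  have hxL : ∀ j : J, x j ∈ L := fun j => by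
    rw [hmemL, hx]
    exact Finsupp.single_mem_supported ℚ _ j.2
  refine ⟨L, D, F, σ, τ.comp L.subtype, h1, le_antisymm ?_ ?_, ?_, ?_, ?_, hτ1, hσ, ?_, ?_⟩
  · -- an element of `L` is determined by its coordinates and its image under `τ`
    let f : L →+ Finsupp.supported ℚ ℚ J × ℚ :=
      ((ψ.comp L.subtype).codRestrict (Finsupp.supported ℚ ℚ J).toAddSubgroup
        fun l => l.2).prod (τ.comp L.subtype)
    have hf : Function.Injective f := by
      refine (injective_iff_map_eq_zero f).2 fun l hl => ?_
      obtain ⟨k, hk⟩ := hψ l (congrArg (fun y => (y.1 : I →₀ ℚ)) hl)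
      have h2 : τ l = 0 := congrArg Prod.snd hl
      rw [hk, ← zsmul_one, map_zsmul, hτ1] at h2
      have h3 : k = 0 := by simpa using h2
      exact Subtype.ext (by rw [hk, h3]; simp)
    refine (Cardinal.mk_le_of_injective hf).trans ?_
    rw [mk_prod, lift_id, lift_id, mk_eq_aleph0 ℚ,
      mk_congr (Finsupp.supportedEquivFinsupp (M := ℚ) (R := ℚ) J).toEquiv, mk_finsupp_rat hμ,
      mul_aleph0_eq hμ]
  · refine Cardinal.mk_le_of_injective (f := fun j : J => (⟨x j, hxL j⟩ : L)) fun j j' h => ?_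
    have h2 : ψ (x j) = ψ (x j') := congrArg (fun l : L => ψ l) h
    rw [hx, hx, Finsupp.single_eq_single_iff] at h2
    rcases h2 with h2 | h2
    · exact Subtype.ext h2.1
    · exact absurd h2.1 (by simp)
  · have hli : LinearIndependent ℚ fun t => z (Sum.inr t) :=
      hz.linearIndependent.comp _ Sum.inr_injective
    rw [mk_congr (Module.Basis.span hli).repr.toEquiv, mk_finsupp_rat hκ]
  · have hDF : D ≤ Subalgebra.toSubmodule F.toSubalgebra :=
      Submodule.span_le.2 (IntermediateField.subset_adjoin _ _)
    exact fun x hx => hDF hx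
  · change ζ (ψ 1) = 0
    rw [hψ1, map_zero]
  · intro m y hy
    rw [hmemL, map_nsmul, ← Nat.cast_smul_eq_nsmul ℚ] at hy
    exact (Submodule.smul_mem_iff _ (by simp)).1 hy
  · obtain ⟨j⟩ : Nonempty J := mk_ne_zero_iff.1 (aleph0_pos.trans_le hμ).ne'
    refine ⟨⟨x j, hxL j⟩, fun hmem => ?_⟩
    obtain ⟨k, hk⟩ := hσ _ hmem
    have h2 : ψ (x j) = k • ψ 1 := by
      rw [← map_zsmul]
      exact congrArg (fun l : L => ψ l) hk
    rw [hx, hψ1, smul_zero, Finsupp.single_eq_zero] at h2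
    simp at h2

theorem exists_rigid_standardDecomposition {κ μ : Cardinal.{0}} (hκ : ℵ₀ ≤ κ)
    (hκ' : κ ≤ 2 ^ ℵ₀) (hμ : ℵ₀ ≤ μ) (hμ' : μ ≤ 2 ^ ℵ₀) :
    ∃ (G : Type) (_ : AddCommGroup G) (_ : LinearOrder G) (_ : IsOrderedAddMonoid G),
      IsOrderedZGroup G ∧ IsRigid addLeLang G ∧ ¬ IsLeibnizian addLeLang G ∧
      ∃ one : G, IsLeast {x : G | 0 < x} one ∧
        ∃ D L : AddSubgroup G, IsStandardDecomposition one D L ∧ #D = κ ∧ #L = μ := by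
  obtain ⟨L, D, F, σ, τ, h1, hLμ, hDκ, hDF, hσ1, hτ1, hσ, hL, l₀, hl₀⟩ :=
    exists_subgroup_subspace hκ hκ' hμ hμ'
  obtain ⟨ord, hord, A, hone, hres, hpos⟩ :=
    exists_zGroupData_prod L D σ τ h1 hσ1 hτ1 (fun l hl => hσ l (hDF _ hl)) hL
  have hres0 : ∀ x : L × D, A.res x = 0 ↔ x.1 = 0 := fun x => by
    rw [hres]; exact ZeroMemClass.coe_eq_zero
  obtain ⟨d, hd⟩ : ∃ d : D, (0 : ℝ) < d := by
    have : Infinite D := infinite_iff.2 (hDκ ▸ hκ)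
    obtain ⟨d, hd⟩ := exists_ne (0 : D)
    rcases lt_or_gt_of_ne (fun h => hd (Subtype.ext h) : (d : ℝ) ≠ 0) with h | h
    · exact ⟨-d, by simpa using h⟩
    · exact ⟨d, h⟩
  let ρ : L × D →+ ℝ := σ.coprod D.subtype.toAddMonoidHom
  have hρ : ∀ x, ρ x = σ x.1 + x.2 := fun x => rfl
  have hρ0 : ∀ x, 0 ≤ x → 0 ≤ ρ x := by
    intro x hx
    rcases hx.eq_or_lt with rfl | hx
    · rw [map_zero]
    · rcases (hpos x).1 hx with h | h
      · exact h.le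
      · exact h.1.ge
  refine ⟨L × D, inferInstance, ord, hord, A.isOrderedZGroup, A.isRigid ρ hρ0 F ?_ ?_ ?_ ?_,
    A.not_isLeibnizian (d := (0, d)) ?_ ?_, A.one, A.least, AddSubgroup.prod ⊥ ⊤,
    AddSubgroup.prod ⊤ ⊥, ⟨?_, ⟨A.res, A.isResidueMap, ?_⟩, ?_, ?_⟩, ?_, ?_⟩
  · intro x hx
    rw [hρ, (hres0 x).1 hx, map_zero, zero_add]
    exact hDF _ x.2.2
  · intro x hx h
    rw [hρ, (hres0 x).1 hx, map_zero, zero_add] at h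
    exact Prod.ext ((hres0 x).1 hx) (Subtype.ext h)
  · exact ⟨(0, d), (hres0 _).2 rfl, by rw [hρ]; simpa using hd⟩
  · exact ⟨(l₀, 0), by rw [hρ]; simpa using hl₀⟩
  · intro j
    rw [← sub_pos, hpos]
    exact Or.inl (by simpa [hone, hσ1] using hd)
  · exact (hres0 _).2 rfl
  · rw [isCompl_iff, AddSubgroup.disjoint_def, codisjoint_iff_le_sup]
    refine ⟨fun {x} hx hy => ?_, fun x _ => ?_⟩
    · exact Prod.ext (AddSubgroup.mem_prod.1 hx).1 (AddSubgroup.mem_prod.1 hy).2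
    · rw [show x = (0, x.2) + (x.1, 0) by simp]
      exact add_mem (AddSubgroup.mem_sup_left (AddSubgroup.mem_prod.2 ⟨rfl, trivial⟩))
        (AddSubgroup.mem_sup_right (AddSubgroup.mem_prod.2 ⟨trivial, rfl⟩))
  · ext x
    rw [AddMonoidHom.mem_ker, hres0, AddSubgroup.mem_prod]
    simp
  · intro n hn x hx
    refine ⟨(0, (n : ℚ)⁻¹ • x.2), AddSubgroup.mem_prod.2 ⟨rfl, trivial⟩,
      Prod.ext ?_ ?_⟩
    · rw [Prod.smul_fst, smul_zero]
      exact (AddSubgroup.mem_prod.1 hx).1.symm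
    · rw [Prod.smul_snd, ← Nat.cast_smul_eq_nsmul ℚ, smul_smul,
        mul_inv_cancel₀ (by exact_mod_cast hn.ne'), one_smul]
  · refine A.isLeibnizianZSubgroup _ ?_ ?_ ?_
    · rw [hone]
      exact AddSubgroup.mem_prod.2 ⟨trivial, rfl⟩
    · intro n x hx h
      obtain ⟨y, hy⟩ := A.div n x h
      refine ⟨(y.1, 0), AddSubgroup.mem_prod.2 ⟨trivial, rfl⟩, Prod.ext ?_ ?_⟩
      · rw [← hy]; rfl
      · rw [Prod.smul_snd, smul_zero]
        exact (AddSubgroup.mem_prod.1 hx).2.symm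
    · intro x hx h
      exact Prod.ext ((hres0 x).1 h) (AddSubgroup.mem_prod.1 hx).2
  · rw [mk_congr (AddSubgroup.prodEquiv _ _).toEquiv, mk_prod, lift_id, lift_id, ← hDκ,
      mk_congr (AddSubgroup.topEquiv (G := D)).toEquiv]
    simp
  · rw [mk_congr (AddSubgroup.prodEquiv _ _).toEquiv, mk_prod, lift_id, lift_id, ← hLμ,
      mk_congr (AddSubgroup.topEquiv (G := L)).toEquiv]
    simp

theorem exists_leibnizian_not_archimedean {κ : Cardinal.{0}} (hκ : ℵ₀ ≤ κ) (hκ' : κ ≤ 2 ^ ℵ₀) :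
    ∃ (G : Type) (_ : AddCommGroup G) (_ : LinearOrder G) (_ : IsOrderedAddMonoid G),
      IsOrderedZGroup G ∧ IsLeibnizian addLeLang G ∧ ¬ Archimedean G ∧ IsRigid addLeLang G ∧
        #G = κ := by
  obtain ⟨L, -, F, σ, τ, h1, hLκ, -, -, hσ1, hτ1, hσ, hL, l₀, hl₀⟩ :=
    exists_subgroup_subspace hκ hκ' hκ hκ'
  obtain ⟨ord, hord, A, hone, hres, hpos⟩ :=
    exists_zGroupData_prod L ⊥ σ τ h1 hσ1 hτ1
      (fun l hl => hσ l (by rw [(Submodule.mem_bot ℚ).1 hl]; exact F.zero_mem)) hL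
  have hleib : IsLeibnizian addLeLang (L × (⊥ : Submodule ℚ ℝ)) :=
    A.isLeibnizian fun x y h => by
      rw [hres, hres] at h
      exact Prod.ext (Subtype.ext h) (Subsingleton.elim _ _)
  refine ⟨L × (⊥ : Submodule ℚ ℝ), inferInstance, ord, hord, A.isOrderedZGroup, hleib,
    fun harch => ?_, hleib.isRigid, ?_⟩
  · obtain ⟨l, hl⟩ : ∃ l, 0 < σ l := by
      have h0 : σ l₀ ≠ 0 := fun h => hl₀ (h ▸ F.zero_mem)
      rcases lt_or_gt_of_ne h0 with h | h
      · exact ⟨-l₀, by simpa using h⟩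
      · exact ⟨l₀, h⟩
    obtain ⟨n, hn⟩ := harch.arch (l, 0) A.one_pos
    refine hn.not_gt ?_
    have h2 : σ (n • ⟨1, h1⟩) = 0 := by rw [map_nsmul, hσ1, smul_zero]
    rw [← sub_pos, hpos, hone]
    refine Or.inl ?_
    change 0 < σ (l - n • ⟨1, h1⟩) + ((0 - n • 0 : (⊥ : Submodule ℚ ℝ)) : ℝ)
    rw [map_sub, h2]
    simpa using hl
  · rw [mk_prod, lift_id, lift_id, hLκ]
    simp

theorem mainTheorem2 :
    (∀ κ μ : Cardinal.{0}, ℵ₀ ≤ κ → κ ≤ 2 ^ ℵ₀ → ℵ₀ ≤ μ → μ ≤ 2 ^ ℵ₀ →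
      ∃ (G : Type) (_ : AddCommGroup G) (_ : LinearOrder G) (_ : IsOrderedAddMonoid G),
        IsOrderedZGroup G ∧ IsRigid addLeLang G ∧ ¬ IsLeibnizian addLeLang G ∧
        ∃ one : G, IsLeast {x : G | 0 < x} one ∧
          ∃ D L : AddSubgroup G, IsStandardDecomposition one D L ∧ #D = κ ∧ #L = μ) ∧
    (∀ κ : Cardinal.{0}, ℵ₀ ≤ κ → κ ≤ 2 ^ ℵ₀ →
      ∃ (G : Type) (_ : AddCommGroup G) (_ : LinearOrder G) (_ : IsOrderedAddMonoid G),
        IsOrderedZGroup G ∧ IsLeibnizian addLeLang G ∧ ¬ Archimedean G ∧ IsRigid addLeLang G ∧ #G = κ) ∧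
    (∀ κ : Cardinal.{0}, ℵ₀ ≤ κ → κ ≤ 2 ^ ℵ₀ →
      ∃ (G : Type) (_ : AddCommGroup G) (_ : LinearOrder G) (_ : IsOrderedAddMonoid G),
        IsOrderedZGroup G ∧ IsRigid addLeLang G ∧ #G = κ) := by
  exact ⟨fun κ μ hκ hκ' hμ hμ' => exists_rigid_standardDecomposition hκ hκ' hμ hμ',
    fun κ hκ hκ' => exists_leibnizian_not_archimedean hκ hκ',
    fun κ hκ hκ' => by
      obtain ⟨G, i₁, i₂, i₃, h₁, -, -, h₂, h₃⟩ := exists_leibnizian_not_archimedean hκ hκ'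
      exact ⟨G, i₁, i₂, i₃, h₁, h₂, h₃⟩⟩
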